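/- Let $K$ be a differential field of characteristic zero with one derivation $\partial$, let $\bar K$ be a differential closure of $K$, and let $C=\{c\in\bar K : \partial c=0\}$ be the field of constants of $\bar K$ (it is an algebraic closure of the field of constants of $K$, and equals the latter when that is algebraically closed). Let $G$ be a linear differential algebraic group over $K$, with coordinate ring $A=K\{G\}$: a reduced, finitely $\partial$-generated differential Hopf algebra over $K$, with $G(B)=\operatorname{Hom}_{\partial\text{-}K}(A,B)$ for every differential $K$-algebra $B$. A differential representation of $G$ is a finite-dimensional $K$-vector space $W$ with an $A$-comodule structure $\rho: W\to W\otimes_K A$; it is faithful if $G(B)\to \mathrm{GL}(W\otimes_K B)$ is injective for every differential $K$-algebra $B$. Its prolongation is $W^{(1)}=K[\partial]_{\le 1}\otimes_K W$, with the coaction $\rho(1\otimes w)=\rho(w)$, $\rho(\partial\otimes w)=\partial(\rho(w))$, where $\partial(w\otimes a)=(\partial\otimes w)\otimes a+(1\otimes w)\otimes\partial a$; it contains $W=1\otimes W$ as a subrepresentation. For an algebraic subgroup $H$ of $\mathrm{GL}_m$ over $C$, the group $H(C)\subset\mathrm{GL}_m(C)$ of constant matrices is regarded as the differential algebraic group over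 $\bar K$ that sends a differential $\bar K$-algebra $R$ to $H(R^{\partial})$; its coordinate ring is $\bar K\otimes_C C[H]$ with $\partial$ zero on $C[H]$. Then the following are equivalent. 1. $G$ is differentially isomorphic over $\bar K$ to an algebraic subgroup of $\mathrm{GL}_m(C)$ for some $m\ge 0$; that is, for some algebraic subgroup $H$ of $\mathrm{GL}_m$ over $C$ the differential Hopf algebras $\bar K\otimes_K A$ and $\bar K\otimes_C C[H]$ over $\bar K$ are isomorphic. 2. There are a faithful differential representation $W$ of $G$ and a differential representation $W_1$ of $G$ with $W_1\cong W$ such that $$\bar K\otimes_K W^{(1)}=\bar K\otimes_K (W\oplus W_1),$$ i.e. there is an isomorphism of representations over $\bar K$ between the two sides which is the identity on $\bar K\otimes_K W$. -/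

import Mathlib

open scoped TensorProduct Differential

universe u

namespace DiffAlgGroup

/-! ### Differential fields -/

section Fields

/-- The field of constants of a differential field. -/
def constants (F : Type u) [Field F] [Differential F] : Subfield F where
  carrier := {x | x′ = 0}
  mul_mem' := by
    intro a b ha hb
    simp only [Set.mem_ofPred_eq] at ha hb ⊢
    simp [ha, hb]
  one_mem' := by simp
  add_mem' := by
    intro a b ha hb
    simp only [Set.mem_ofPred_eq] at ha hb ⊢
    simp [ha, hb]
  zero_mem' := by simp
  neg_mem' := by
    intro a ha
    simp only [Set.mem_ofPred_eq] at ha ⊢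
    simp [ha]
  inv_mem' := by
    intro a ha
    simp only [Set.mem_ofPred_eq] at ha ⊢
    simp [Derivation.leibniz_inv, ha]

/-- The derivation of a differential field is linear over its constants. -/
noncomputable def constDeriv (F : Type u) [Field F] [Differential F] :
    F →ₗ[constants F] F where
  toFun x := (x′)
  map_add' := by simp
  map_smul' := by
    rintro ⟨c, hc⟩ x
    have hc' : c′ = 0 := hc
    simp [Subfield.smul_def, hc']

/-- The ring `F{y₁, …, yₙ}` of differential polynomials; the variable `(j, i)` is the `i`-th
derivative of `y_j`. -/
abbrev DiffPoly (F : Type u) [Field F] (n : ℕ) : Type u := MvPolynomial (Fin n × ℕ) F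

/-- The value of a differential polynomial at a point of `Lⁿ`, for a differential extension `L`. -/
noncomputable def DiffPoly.value {F : Type u} [Field F] {n : ℕ} (L : Type u) [Field L]
    [Differential L] [Algebra F L] (a : Fin n → L) (f : DiffPoly F n) : L :=
  MvPolynomial.aeval (fun p : Fin n × ℕ => (fun x : L => x′)^[p.2] (a p.1)) f

/-- `F` is differentially closed: every finite system of differential polynomial equations over `F`
that is solvable in some differential field extension of `F` is solvable in `F`. -/
def IsDifferentiallyClosed (F : Type u) [Field F] [Differential F] : Prop :=
  ∀ (n : ℕ) (S : Finset (DiffPoly F n)) (L : Type u) [Field L] [Differential L] [Algebra F L]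
    [DifferentialAlgebra F L],
    (∃ a : Fin n → L, ∀ f ∈ S, DiffPoly.value L a f = 0) →
      ∃ a : Fin n → F, ∀ f ∈ S, DiffPoly.value F a f = 0

/-- `F` is a differential closure of `K`: it is a differentially closed extension of `K` which
embeds over `K` in every differentially closed extension of `K`. -/
structure IsDifferentialClosure (K F : Type u) [Field K] [Differential K] [Field F]
    [Differential F] [Algebra K F] [DifferentialAlgebra K F] : Prop where
  closed : IsDifferentiallyClosed F
  embeds : ∀ (L : Type u) [Field L] [Differential L] [Algebra K L] [DifferentialAlgebra K L],
    IsDifferentiallyClosed L → ∃ σ : F →ₐ[K] L, ∀ x : F, σ x′ = (σ x)′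

end Fields

/-! ### Derivations on tensor products -/

section Tensor

variable {K : Type u} [Field K] [Differential K]
  {X X' Y : Type u} [AddCommGroup X] [Module K X] [AddCommGroup X'] [Module K X']
  [AddCommGroup Y] [Module K Y]

/-- The additive map `x ⊗ y ↦ f₁ x ⊗ y + f₀ x ⊗ δ y` on `X ⊗ Y`, where `f₁` and `δ` satisfy
Leibniz rules with respect to scalars. -/
noncomputable def tensorLeibniz (f₀ : X →ₗ[K] X') (f₁ : X →+ X')
    (hf : ∀ (c : K) (x : X), f₁ (c • x) = c • f₁ x + c′ • f₀ x)
    (δ : Y →+ Y) (hδ : ∀ (c : K) (y : Y), δ (c • y) = c • δ y + c′ • y) :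
    X ⊗[K] Y →+ X' ⊗[K] Y :=
  TensorProduct.liftAddHom
    (AddMonoidHom.mk' (fun x => AddMonoidHom.mk' (fun y => f₁ x ⊗ₜ[K] y + f₀ x ⊗ₜ[K] δ y)
        (by intro a b; simp only [map_add, TensorProduct.tmul_add]; abel))
      (by
        intro a b
        ext y
        simp only [AddMonoidHom.mk'_apply, AddMonoidHom.add_apply, map_add,
          TensorProduct.add_tmul]
        abel))
    (by
      intro c x y
      simp only [AddMonoidHom.mk'_apply, hf, hδ, map_smul, TensorProduct.add_tmul,
        TensorProduct.tmul_add, TensorProduct.tmul_smul, TensorProduct.smul_tmul']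
      abel)

@[simp]
theorem tensorLeibniz_tmul (f₀ : X →ₗ[K] X') (f₁ : X →+ X')
    (hf : ∀ (c : K) (x : X), f₁ (c • x) = c • f₁ x + c′ • f₀ x)
    (δ : Y →+ Y) (hδ : ∀ (c : K) (y : Y), δ (c • y) = c • δ y + c′ • y) (x : X) (y : Y) :
    tensorLeibniz f₀ f₁ hf δ hδ (x ⊗ₜ y) = f₁ x ⊗ₜ y + f₀ x ⊗ₜ δ y := rfl

/-- The derivation of a differential `K`-algebra, as an additive map. -/
def derivHom (S : Type u) [CommRing S] [Differential S] : S →+ S where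
  toFun x := (x′)
  map_zero' := by simp
  map_add' := by simp

@[simp]
theorem derivHom_apply {S : Type u} [CommRing S] [Differential S] (x : S) :
    derivHom S x = (x′) := rfl

theorem derivHom_smul {S : Type u} [CommRing S] [Differential S] [Algebra K S]
    [DifferentialAlgebra K S] (c : K) (x : S) :
    derivHom S (c • x) = c • derivHom S x + c′ • x := by
  simp [Algebra.smul_def, deriv_algebraMap, mul_comm, add_comm]

/-- The derivation `∂(s ⊗ t) = ∂s ⊗ t + s ⊗ ∂t` of the tensor product of two differential
`K`-algebras. -/
noncomputable def tensorDeriv (K : Type u) [Field K] [Differential K] (S T : Type u) [CommRing S]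
    [Differential S] [Algebra K S] [DifferentialAlgebra K S] [CommRing T] [Differential T]
    [Algebra K T] [DifferentialAlgebra K T] : S ⊗[K] T →+ S ⊗[K] T :=
  tensorLeibniz LinearMap.id (derivHom S) (fun c x => derivHom_smul c x)
    (derivHom T) (fun c x => derivHom_smul c x)

theorem tensorDeriv_smul {S T : Type u} [CommRing S]
    [Differential S] [Algebra K S] [DifferentialAlgebra K S] [CommRing T] [Differential T]
    [Algebra K T] [DifferentialAlgebra K T] (c : K) (z : S ⊗[K] T) :
    tensorDeriv K S T (c • z) = c • tensorDeriv K S T z + c′ • z := by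
  induction z with
  | zero => simp
  | add a b ha hb => simp only [smul_add, map_add, ha, hb]; abel
  | tmul s t =>
    simp only [TensorProduct.smul_tmul', tensorDeriv, tensorLeibniz_tmul, derivHom_smul,
      map_smul, TensorProduct.add_tmul, smul_add, LinearMap.id_apply]
    abel

end Tensor

/-! ### Linear differential algebraic groups -/

/-- The structure maps of the Hopf algebra `A` are differential homomorphisms, that is, `A` is a
differential Hopf algebra over `K`. -/
class DiffHopfAlgebra (K A : Type u) [Field K] [Differential K] [CommRing A] [HopfAlgebra K A]
    [Differential A] [DifferentialAlgebra K A] : Prop where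
  comul_deriv : ∀ a : A, Coalgebra.comul (R := K) a′ = tensorDeriv K A A (Coalgebra.comul a)
  counit_deriv : ∀ a : A, Coalgebra.counit (R := K) a′ = ((Coalgebra.counit (R := K) a)′)
  antipode_deriv : ∀ a : A, HopfAlgebra.antipode K a′ = ((HopfAlgebra.antipode K a)′)

/-- `A` is finitely differentially generated over `K`. -/
def IsDiffFinite (K A : Type u) [Field K] [CommRing A] [Algebra K A] [Differential A] : Prop :=
  ∃ S : Finset A, Algebra.adjoin K {x : A | ∃ s ∈ S, ∃ i : ℕ, x = (fun a : A => a′)^[i] s} = ⊤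

/-- The coordinate ring of a linear differential algebraic group over `K`: a reduced, finitely
differentially generated differential Hopf algebra. The group is the functor
`B ↦ {differential K-algebra homomorphisms A → B}` (see `Points`). -/
class IsLinearDiffAlgGroup (K A : Type u) [Field K] [Differential K] [CommRing A]
    [HopfAlgebra K A] [Differential A] [DifferentialAlgebra K A] : Prop
    extends DiffHopfAlgebra K A, IsReduced A where
  diffFinite : IsDiffFinite K A

/-- The `B`-points `G(B)` of the group with coordinate ring `A`. -/
def Points (K A B : Type u) [Field K] [CommRing A] [Algebra K A] [Differential A]
    [CommRing B] [Algebra K B] [Differential B] : Type u :=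
  {g : A →ₐ[K] B // ∀ a : A, g a′ = (g a)′}

/-! ### Prolongation of vector spaces -/

/-- The prolongation `V⁽¹⁾ = K[∂]_{≤ 1} ⊗ V`. Every element of it is `1 ⊗ w + ∂ ⊗ v` for a unique
pair `(w, v)`, and the left scalar multiplication is
`c (1 ⊗ w + ∂ ⊗ v) = 1 ⊗ (c w - c′ v) + ∂ ⊗ c v`, because `c ∂ = ∂ c - c′` in `K[∂]`. -/
def Prolong (_K V : Type u) : Type u := V × V

namespace Prolong

variable (K : Type u) [Field K] [Differential K] {V M : Type u} [AddCommGroup V] [Module K V]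
  [AddCommGroup M] [Module K M]

instance : AddCommGroup (Prolong K V) := inferInstanceAs (AddCommGroup (V × V))

/-- `w ↦ 1 ⊗ w`, as an additive map. -/
def inclAdd : V →+ Prolong K V := AddMonoidHom.inl V V

/-- `v ↦ ∂ ⊗ v`. -/
def del : V →+ Prolong K V := AddMonoidHom.inr V V

instance : Module K (Prolong K V) where
  smul c x := (c • x.1 - c′ • x.2, c • x.2)
  one_smul := by
    rintro ⟨w, v⟩
    refine Prod.ext ?_ (one_smul K v)
    change (1 : K) • w - (1 : K)′ • v = w
    simp
  mul_smul := by
    rintro a b ⟨w, v⟩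
    refine Prod.ext ?_ (mul_smul a b v)
    change (a * b) • w - (a * b)′ • v = a • (b • w - b′ • v) - a′ • (b • v)
    simp only [Derivation.leibniz, smul_eq_mul, add_smul, smul_sub, mul_smul]
    rw [smul_comm b a′ v]
    abel
  smul_zero := by
    intro a
    exact Prod.ext (by change a • (0 : V) - a′ • (0 : V) = 0; simp) (smul_zero a)
  smul_add := by
    rintro a ⟨w, v⟩ ⟨w', v'⟩
    refine Prod.ext ?_ (smul_add a v v')
    change a • (w + w') - a′ • (v + v') = (a • w - a′ • v) + (a • w' - a′ • v')
    simp only [smul_add]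
    abel
  add_smul := by
    rintro a b ⟨w, v⟩
    refine Prod.ext ?_ (add_smul a b v)
    change (a + b) • w - (a + b)′ • v = (a • w - a′ • v) + (b • w - b′ • v)
    simp only [map_add, add_smul]
    abel
  zero_smul := by
    rintro ⟨w, v⟩
    refine Prod.ext ?_ (zero_smul K v)
    change (0 : K) • w - (0 : K)′ • v = 0
    simp

/-- The canonical embedding `V → V⁽¹⁾`, `w ↦ 1 ⊗ w`. -/
def incl : V →ₗ[K] Prolong K V where
  toFun := inclAdd K
  map_add' := map_add _
  map_smul' := by
    intro c w
    refine Prod.ext ?_ ?_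
    · change c • w = c • w - c′ • (0 : V)
      simp
    · change (0 : V) = c • (0 : V)
      simp

/-- `∂ ⊗ c v = c ∂ ⊗ v + c′ ⊗ v`. -/
theorem del_smul (c : K) (v : V) : del K (c • v) = c • del K v + c′ • incl K v := by
  refine Prod.ext ?_ ?_
  · change (0 : V) = (c • (0 : V) - c′ • v) + (c′ • v - (c′)′ • (0 : V))
    simp
  · change c • v = c • v + c′ • (0 : V)
    simp

theorem eq_incl_add_del (x : Prolong K V) : x = incl K x.1 + del K x.2 :=
  Prod.ext (by change x.1 = x.1 + 0; simp) (by change x.2 = 0 + x.2; simp)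

variable {K}

/-- The universal property of `K[∂]_{≤ 1} ⊗ V`: the linear map with `1 ⊗ w ↦ f₀ w` and
`∂ ⊗ v ↦ f₁ v`. -/
def lift (f₀ : V →ₗ[K] M) (f₁ : V →+ M)
    (hf : ∀ (c : K) (v : V), f₁ (c • v) = c • f₁ v + c′ • f₀ v) : Prolong K V →ₗ[K] M where
  toFun x := f₀ x.1 + f₁ x.2
  map_add' := by
    rintro ⟨w, v⟩ ⟨w', v'⟩
    change f₀ (w + w') + f₁ (v + v') = (f₀ w + f₁ v) + (f₀ w' + f₁ v')
    simp only [map_add]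
    abel
  map_smul' := by
    rintro c ⟨w, v⟩
    change f₀ (c • w - c′ • v) + f₁ (c • v) = c • (f₀ w + f₁ v)
    simp only [map_sub, map_smul, hf, smul_add]
    abel

@[simp]
theorem lift_incl (f₀ : V →ₗ[K] M) (f₁ : V →+ M)
    (hf : ∀ (c : K) (v : V), f₁ (c • v) = c • f₁ v + c′ • f₀ v) (w : V) :
    lift f₀ f₁ hf (incl K w) = f₀ w := by
  change f₀ w + f₁ 0 = f₀ w
  simp

@[simp]
theorem lift_del (f₀ : V →ₗ[K] M) (f₁ : V →+ M)
    (hf : ∀ (c : K) (v : V), f₁ (c • v) = c • f₁ v + c′ • f₀ v) (v : V) :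
    lift f₀ f₁ hf (del K v) = f₁ v := by
  change f₀ 0 + f₁ v = f₁ v
  simp

end Prolong

/-! ### Differential representations -/

/-- A differential representation, on the `K`-vector space `V`, of the group with coordinate ring
`A`, as a comodule structure `V → V ⊗ A`. -/
structure DiffRep (K A V : Type u) [Field K] [CommRing A] [HopfAlgebra K A] [AddCommGroup V]
    [Module K V] where
  /-- The coaction. -/
  coact : V →ₗ[K] V ⊗[K] A
  coassoc : ∀ v : V, TensorProduct.assoc K V A A (coact.rTensor A (coact v)) =
    (Coalgebra.comul (R := K) (A := A)).lTensor V (coact v)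
  counit : ∀ v : V,
    TensorProduct.rid K V ((Coalgebra.counit (R := K) (A := A)).lTensor V (coact v)) = v

namespace DiffRep

variable {K A V W : Type u} [Field K] [CommRing A] [HopfAlgebra K A]
  [AddCommGroup V] [Module K V] [AddCommGroup W] [Module K W]

/-- The action of `g ∈ G(B)` on `V ⊗ B`, restricted to `V` (which determines it by
`B`-linearity). -/
noncomputable def act [Differential A] (r : DiffRep K A V) {B : Type u} [CommRing B] [Algebra K B]
    [Differential B] (g : Points K A B) : V →ₗ[K] V ⊗[K] B :=
  g.1.toLinearMap.lTensor V ∘ₗ r.coact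

/-- `V` is faithful: the homomorphism `G(B) → GL(V ⊗ B)` is injective for every differential
`K`-algebra `B`. -/
def IsFaithful [Differential K] [Differential A] (r : DiffRep K A V) : Prop :=
  ∀ (B : Type u) [CommRing B] [Algebra K B] [Differential B] [DifferentialAlgebra K B],
    Function.Injective fun g : Points K A B => r.act g

/-- `V` and `W` are isomorphic as representations. -/
def Iso (r : DiffRep K A V) (s : DiffRep K A W) : Prop :=
  ∃ f : V ≃ₗ[K] W, ∀ v : V, s.coact (f v) = f.toLinearMap.rTensor A (r.coact v)

section Aux

variable {U : Type u} [AddCommGroup U] [Module K U]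

theorem coassoc_of_intertwine (r : DiffRep K A V) (τ : U →ₗ[K] U ⊗[K] A) (f : V →ₗ[K] U)
    (h : τ ∘ₗ f = f.rTensor A ∘ₗ r.coact) (v : V) :
    TensorProduct.assoc K U A A (τ.rTensor A (f.rTensor A (r.coact v))) =
      (Coalgebra.comul (R := K) (A := A)).lTensor U (f.rTensor A (r.coact v)) := by
  have h1 : ∀ z : (V ⊗[K] A) ⊗[K] A, TensorProduct.assoc K U A A ((f.rTensor A).rTensor A z) =
      f.rTensor (A ⊗[K] A) (TensorProduct.assoc K V A A z) := by
    intro z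
    rw [LinearMap.rTensor_tensor]
    simp
  rw [← LinearMap.comp_apply (τ.rTensor A), ← LinearMap.rTensor_comp, h, LinearMap.rTensor_comp,
    LinearMap.comp_apply, h1, r.coassoc, ← LinearMap.comp_apply, ← LinearMap.comp_apply,
    LinearMap.rTensor_comp_lTensor, ← LinearMap.lTensor_comp_rTensor]
  rfl

theorem counit_of_map (r : DiffRep K A V) (f : V →ₗ[K] U) (v : V) :
    TensorProduct.rid K U ((Coalgebra.counit (R := K) (A := A)).lTensor U
      (f.rTensor A (r.coact v))) = f v := by
  have h1 : ∀ z : V ⊗[K] K, TensorProduct.rid K U (f.rTensor K z) =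
      f (TensorProduct.rid K V z) := by
    intro z
    induction z with
    | zero => simp
    | add a b ha hb => simp only [map_add, ha, hb]
    | tmul a b => simp
  rw [← LinearMap.comp_apply, LinearMap.lTensor_comp_rTensor, ← LinearMap.rTensor_comp_lTensor,
    LinearMap.comp_apply, h1, r.counit]

end Aux

/-- The direct sum of two representations. -/
noncomputable def directSum (r : DiffRep K A V) (s : DiffRep K A W) : DiffRep K A (V × W) where
  coact := LinearMap.coprod ((LinearMap.inl K V W).rTensor A ∘ₗ r.coact)
    ((LinearMap.inr K V W).rTensor A ∘ₗ s.coact)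
  coassoc := by
    rintro ⟨v, w⟩
    simp only [LinearMap.coprod_apply, LinearMap.comp_apply, map_add]
    congr 1
    · exact coassoc_of_intertwine r _ _ (by ext x; simp) v
    · exact coassoc_of_intertwine s _ _ (by ext x; simp) w
  counit := by
    rintro ⟨v, w⟩
    simp only [LinearMap.coprod_apply, LinearMap.comp_apply, map_add, counit_of_map]
    simp

section Prolong

variable [Differential K] [Differential A] [DifferentialAlgebra K A]

variable (K A V) in
/-- The map `∂ : V ⊗ A → V⁽¹⁾ ⊗ A`, `∂(v ⊗ a) = ∂v ⊗ a + v ⊗ ∂a`. -/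
noncomputable def delTensor : V ⊗[K] A →+ Prolong K V ⊗[K] A :=
  tensorLeibniz (Prolong.incl K) (Prolong.del K) (Prolong.del_smul K)
    (derivHom A) (fun c a => derivHom_smul c a)

theorem delTensor_tmul (v : V) (a : A) : delTensor K A V (v ⊗ₜ a) =
    Prolong.del K v ⊗ₜ a + Prolong.incl K v ⊗ₜ (a′) := rfl

theorem delTensor_smul (c : K) (z : V ⊗[K] A) : delTensor K A V (c • z) =
    c • delTensor K A V z + c′ • (Prolong.incl K).rTensor A z := by
  induction z with
  | zero => simp
  | add a b ha hb => simp only [smul_add, map_add, ha, hb]; abel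
  | tmul v a =>
    simp only [TensorProduct.smul_tmul', delTensor, tensorLeibniz_tmul, Prolong.del_smul,
      map_smul, TensorProduct.add_tmul, LinearMap.rTensor_tmul, smul_add]
    abel

/-- The prolonged coaction on `V⁽¹⁾`: `ρ(1 ⊗ v) = ρ(v)` and `ρ(∂ ⊗ v) = ∂(ρ(v))`. -/
noncomputable def prolongCoact (r : DiffRep K A V) :
    Prolong K V →ₗ[K] Prolong K V ⊗[K] A :=
  Prolong.lift ((Prolong.incl K).rTensor A ∘ₗ r.coact)
    ((delTensor K A V).comp r.coact.toAddMonoidHom)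
    (by
      intro c v
      simp [delTensor_smul])

theorem prolongCoact_incl (r : DiffRep K A V) (v : V) :
    r.prolongCoact (Prolong.incl K v) = (Prolong.incl K).rTensor A (r.coact v) :=
  Prolong.lift_incl _ _ _ v

theorem prolongCoact_del (r : DiffRep K A V) (v : V) :
    r.prolongCoact (Prolong.del K v) = delTensor K A V (r.coact v) :=
  Prolong.lift_del _ _ _ v

variable (K A V) in
/-- The map `∂ : V ⊗ (A ⊗ A) → V⁽¹⁾ ⊗ (A ⊗ A)`. -/
noncomputable def delTensor₂ : V ⊗[K] (A ⊗[K] A) →+ Prolong K V ⊗[K] (A ⊗[K] A) :=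
  tensorLeibniz (Prolong.incl K) (Prolong.del K) (Prolong.del_smul K)
    (tensorDeriv K A A) (fun c z => tensorDeriv_smul c z)

/-- The prolongation `V⁽¹⁾` of a representation `V`. -/
noncomputable def prolong [DiffHopfAlgebra K A] (r : DiffRep K A V) :
    DiffRep K A (Prolong K V) where
  coact := r.prolongCoact
  coassoc := by
    intro x
    rw [Prolong.eq_incl_add_del K x]
    simp only [map_add, prolongCoact_incl, prolongCoact_del]
    congr 1
    · exact coassoc_of_intertwine r _ _ (by ext v; simp [prolongCoact_incl]) x.1
    · have h1 : ∀ z : V ⊗[K] A, TensorProduct.assoc K (Prolong K V) A A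
          (r.prolongCoact.rTensor A (delTensor K A V z)) =
          delTensor₂ K A V (TensorProduct.assoc K V A A (r.coact.rTensor A z)) := by
        intro z
        induction z with
        | zero => simp
        | add a b ha hb => simp only [map_add, ha, hb]
        | tmul v a =>
          simp only [delTensor_tmul, map_add, LinearMap.rTensor_tmul, prolongCoact_incl,
            prolongCoact_del]
          generalize r.coact v = y
          induction y with
          | zero => simp
          | add p q hp hq =>
            simp only [map_add, TensorProduct.add_tmul] at hp hq ⊢
            rw [← hp, ← hq]
            abel
          | tmul p q =>
            simp [delTensor_tmul, delTensor₂, tensorDeriv, TensorProduct.add_tmul,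
              TensorProduct.tmul_add, add_assoc]
      have h2 : ∀ z : V ⊗[K] A, (Coalgebra.comul (R := K) (A := A)).lTensor (Prolong K V)
          (delTensor K A V z) =
          delTensor₂ K A V ((Coalgebra.comul (R := K) (A := A)).lTensor V z) := by
        intro z
        induction z with
        | zero => simp
        | add a b ha hb => simp only [map_add, ha, hb]
        | tmul v a => simp [delTensor_tmul, delTensor₂, DiffHopfAlgebra.comul_deriv]
      rw [h1, h2, r.coassoc]
  counit := by
    intro x
    have h : ∀ z : V ⊗[K] A, TensorProduct.rid K (Prolong K V)
        ((Coalgebra.counit (R := K) (A := A)).lTensor (Prolong K V) (delTensor K A V z)) =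
        Prolong.del K (TensorProduct.rid K V
          ((Coalgebra.counit (R := K) (A := A)).lTensor V z)) := by
      intro z
      induction z with
      | zero => simp
      | add a b ha hb => simp only [map_add, ha, hb]
      | tmul v a => simp [delTensor_tmul, Prolong.del_smul, DiffHopfAlgebra.counit_deriv]
    conv_lhs => rw [Prolong.eq_incl_add_del K x]
    simp only [map_add, prolongCoact_incl, prolongCoact_del, h, r.counit]
    rw [counit_of_map]
    exact (Prolong.eq_incl_add_del K x).symm

end Prolong

/-- The coaction of `A` on `F ⊗ V` for a field extension `F` of `K` (note that
`(F ⊗ V) ⊗_K A = (F ⊗ V) ⊗_F (F ⊗ A)`). -/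
noncomputable def coactBaseChange (F : Type u) [Field F] [Algebra K F] (r : DiffRep K A V) :
    F ⊗[K] V →ₗ[K] (F ⊗[K] V) ⊗[K] A :=
  (TensorProduct.assoc K F V A).symm.toLinearMap ∘ₗ r.coact.lTensor F

/-- The equality `F ⊗ V⁽¹⁾ = F ⊗ (V ⊕ V₁)`: an isomorphism of representations over `F` which is the
identity on `F ⊗ V`. -/
def ProlongSplits [Differential K] [Differential A] [DifferentialAlgebra K A]
    [DiffHopfAlgebra K A] (F : Type u) [Field F] [Algebra K F] (r : DiffRep K A V)
    (r₁ : DiffRep K A W) : Prop :=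
  ∃ e : F ⊗[K] Prolong K V ≃ₗ[F] F ⊗[K] (V × W),
    (∀ x, (r.directSum r₁).coactBaseChange F (e x) =
      (e.toLinearMap.restrictScalars K).rTensor A (r.prolong.coactBaseChange F x)) ∧
    ∀ (c : F) (v : V), e (c ⊗ₜ Prolong.incl K v) = c ⊗ₜ ((v, 0) : V × W)

end DiffRep

/-! ### Algebraic groups of constant matrices -/

/-- The commutative Hopf algebra `B` over the field `C` is the coordinate ring of an algebraic
subgroup of `GL_m`, embedded through the matrix `x` of coordinate functions: the assignment
`X ↦ x` is a surjective homomorphism of Hopf algebras `C[X, 1/det X] → B`. -/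
structure IsAlgebraicSubgroupGL (C B : Type u) [Field C] [CommRing B] [HopfAlgebra C B] {m : ℕ}
    (x : Matrix (Fin m) (Fin m) B) : Prop where
  comul : ∀ i j, Coalgebra.comul (R := C) (x i j) = ∑ k, x i k ⊗ₜ[C] x k j
  counit : ∀ i j, Coalgebra.counit (R := C) (x i j) = (1 : Matrix (Fin m) (Fin m) C) i j
  generates : ∃ d : B, d * x.det = 1 ∧
    Algebra.adjoin C (insert d (Set.range fun p : Fin m × Fin m => x p.1 p.2)) = ⊤

/-- Let `C` be the field of constants of `F`, and `B` the coordinate ring of an algebraic group `H`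
over `C`. The group `H(C)` of constant points, as a differential algebraic group over `F`, is the
functor sending a differential `F`-algebra `R` to the points of `H` in the ring of constants of
`R`; its coordinate ring is `F ⊗_C B`, with the derivation `∂(c ⊗ b) = ∂c ⊗ b`. -/
noncomputable def constTensorDeriv (F B : Type u) [Field F] [Differential F] [CommRing B]
    [Algebra (constants F) B] :
    F ⊗[constants F] B →ₗ[constants F] F ⊗[constants F] B :=
  (constDeriv F).rTensor B

/-- The group `G` with coordinate ring `A` is differentially isomorphic over `F` to the group of
constant points of the algebraic group with coordinate ring `B`: there is an isomorphism of
differential Hopf algebras over `F` between their coordinate rings. -/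
def DiffIsoConst (K F A B : Type u) [Field K] [Differential K] [Field F] [Differential F]
    [Algebra K F] [DifferentialAlgebra K F] [CommRing A] [HopfAlgebra K A] [Differential A]
    [DifferentialAlgebra K A] [CommRing B] [HopfAlgebra (constants F) B] : Prop :=
  ∃ φ : F ⊗[K] A ≃ₐc[F] F ⊗[constants F] B,
    ∀ x, φ (tensorDeriv K F A x) = constTensorDeriv F B (φ x)

/-- `G` is differentially isomorphic over `F` to an algebraic subgroup of some `GL_m(C)`, where `C`
is the field of constants of `F`. -/
def IsIsoToConstantGroup (K F A : Type u) [Field K] [Differential K] [Field F] [Differential F]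
    [Algebra K F] [DifferentialAlgebra K F] [CommRing A] [HopfAlgebra K A] [Differential A]
    [DifferentialAlgebra K A] : Prop :=
  ∃ (m : ℕ) (B : Type u) (_ : CommRing B) (_ : HopfAlgebra (constants F) B)
    (x : Matrix (Fin m) (Fin m) B),
    IsAlgebraicSubgroupGL (constants F) B x ∧ DiffIsoConst K F A B

end DiffAlgGroup

/-! Write F for the differential closure and C for its constants.

From constant groups to splittings. If F ⊗ A is F ⊗_C B with B constant, then elements 1 ⊗ b span
F-subspaces stable under ∂, so every finite subset of A lies in a finite-dimensional ∂-stable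
K-subspace N (`DiffIsoConst.exists_submodule`). Take N to contain differential generators of A. The
span W of its translates a₁ f(a₂) is still finite-dimensional and ∂-stable, and it is a subcomodule
of A; it is faithful because it contains generators. Since ∂ acts on W compatibly with the coaction,
1 ⊗ w ↦ (w, 0), ∂ ⊗ v ↦ (∂v, v) is an isomorphism from the prolongation to W ⊕ W, already over K
(`prolongSplits_of_deriv`).

From splittings to constant groups. Let g be the matrix of W in a basis. A splitting that is the
identity on W gives a matrix β over F with gβ = βg + g′ (`ProlongSplits.exists_matrix`). Since F is
differentially closed, P′ = -βP has an invertible solution over F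
(`IsDifferentiallyClosed.exists_fundamental`), and then h = P⁻¹gP is constant
(`deriv_conj_eq_zero`). The entries of h and 1/det h generate F ⊗ A as an F-algebra, because g and
1/det g generate A differentially. Constants are linearly disjoint from F over C, so the C-algebra B
generated by these coordinates satisfies F ⊗_C B = F ⊗ A, and the Hopf structure restricts to B
(`exists_hopfAlgebra_form`).

The remaining point is that faithfulness forces g and 1/det g to generate A
(`IsFaithful.diffAdjoin_coordinates`). They generate a differential Hopf subalgebra A₀. The two maps
from A to A ⊗_{A₀} A are points of G with the same action on W, hence equal, so A₀ → A is an
epimorphism of rings. A Hopf subalgebra of a reduced commutative Hopf algebra with epimorphic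
inclusion is everything (`Subalgebra.eq_top_of_isEpi`): the inclusion is generically surjective, and
the Hopf structure removes the denominator. -/

/-! ### Generic surjectivity of ring epimorphisms. -/

/-- An epimorphism from a nonzero reduced ring is generically surjective. -/
theorem Algebra.IsEpi.exists_ne_zero_smul_mem_range {R A : Type*} [CommRing R] [IsReduced R]
    [Nontrivial R] [CommRing A] [Algebra R A] [Algebra.IsEpi R A] (T : Finset A) :
    ∃ s : R, s ≠ 0 ∧ ∀ y ∈ T, ∃ b : R, s • y = algebraMap R A b := by
  obtain ⟨p, hp⟩ : (minimalPrimes R).Nonempty :=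
    Set.nonempty_coe_sort.mp (Ideal.nonempty_minimalPrimes bot_ne_top)
  have : p.IsPrime := hp.1.1
  -- The localization at a minimal prime of a reduced ring is local, reduced and zero-dimensional,
  -- hence a field k.
  have hdim : Ring.KrullDimLE 0 (Localization.AtPrime p) := Ring.KrullDimLE.of_isLocalization p hp _
  have hred : IsReduced (Localization.AtPrime p) :=
    isReduced_localizationPreserves p.primeCompl _ inferInstance
  let k := Localization.AtPrime p
  let _ : Field k := (Ring.KrullDimLE.isField_of_isReduced (R := k)).toField
  have epi : ∀ y : A, (1 : k ⊗[R] A) ⊗ₜ[k] ((1 : k) ⊗ₜ[R] y) = ((1 : k) ⊗ₜ[R] y) ⊗ₜ[k] 1 := by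
    intro y
    let i : A →ₗ[R] k ⊗[R] A := TensorProduct.mk R k A 1
    have h := (Algebra.isEpi_iff_forall_one_tmul_eq R A).mp inferInstance y
    have h' := congrArg (TensorProduct.mapOfCompatibleSMul k R R (k ⊗[R] A) (k ⊗[R] A) ∘
      _root_.TensorProduct.map i i) h
    simpa [i, Algebra.TensorProduct.one_def] using h'
  have key : ∀ y : A, ∃ s ∈ p.primeCompl, ∃ b : R, s • y = algebraMap R A b := by
    intro y
    have hmem : ((1 : k) ⊗ₜ[R] y) ∈ Submodule.span k {(1 : k ⊗[R] A)} := by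
      -- A functional f with f(1) = 0 and f(y) ≠ 0, applied to the left factor of 1 ⊗ y = y ⊗ 1,
      -- gives 0 = f(y) • 1. So k ⊗ A = 0, which is absurd.
      by_contra hy
      obtain ⟨f, hf, hf1⟩ := Submodule.exists_dual_map_eq_bot_of_notMem hy inferInstance
      have h1 : f 1 = 0 := by
        have : f 1 ∈ Submodule.map f (Submodule.span k {(1 : k ⊗[R] A)}) :=
          ⟨1, Submodule.mem_span_singleton_self _, rfl⟩
        simpa [hf1] using this
      have h2 := congrArg (TensorProduct.lid k (k ⊗[R] A) ∘ f.rTensor (k ⊗[R] A)) (epi y)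
      simp only [Function.comp_apply, LinearMap.rTensor_tmul, h1, TensorProduct.zero_tmul,
        map_zero, TensorProduct.lid_tmul] at h2
      have h3 : (1 : k ⊗[R] A) = 0 := (smul_eq_zero.mp h2.symm).resolve_left hf
      apply hy
      rw [← one_mul ((1 : k) ⊗ₜ[R] y), h3, zero_mul]
      exact zero_mem _
    obtain ⟨c, hc⟩ := Submodule.mem_span_singleton.mp hmem
    obtain ⟨b, t, rfl⟩ := IsLocalization.exists_mk'_eq p.primeCompl c
    have h : TensorProduct.mk R k A 1 (t.1 • y) = TensorProduct.mk R k A 1 (algebraMap R A b) := by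
      rw [map_smul, TensorProduct.mk_apply, ← hc, TensorProduct.mk_apply,
        Algebra.TensorProduct.one_def, TensorProduct.smul_tmul', TensorProduct.smul_tmul',
        Algebra.algebraMap_eq_smul_one, ← TensorProduct.smul_tmul]
      congr 1
      rw [smul_eq_mul, mul_one, ← Algebra.algebraMap_eq_smul_one, Algebra.smul_def]
      exact IsLocalization.mk'_spec' _ _ _
    obtain ⟨s, hs⟩ := (IsLocalizedModule.eq_iff_exists p.primeCompl (TensorProduct.mk R k A 1)).mp h
    refine ⟨s * t, mul_mem s.2 t.2, s * b, ?_⟩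
    rw [mul_smul, map_mul, ← Algebra.smul_def]
    exact hs
  choose s hs b hb using key
  refine ⟨∏ y ∈ T, s y, ?_, ?_⟩
  · intro h
    exact (prod_mem (fun y _ => hs y) : ∏ y ∈ T, s y ∈ p.primeCompl) (h ▸ zero_mem p)
  · intro y hy
    classical
    refine ⟨(∏ z ∈ T.erase y, s z) * b y, ?_⟩
    rw [← Finset.prod_erase_mul _ _ hy, mul_smul, hb, map_mul, Algebra.smul_def]

/-! ### Canonical maps of a Hopf algebra. -/

namespace HopfAlgebra

open Coalgebra

variable {K A : Type*} [Field K] [CommRing A] [HopfAlgebra K A]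

variable (K A) in
/-- The map `x ⊗ y ↦ (S x ⊗ 1) Δ y`. -/
noncomputable def antipodeMulComul : A ⊗[K] A →ₗ[K] A ⊗[K] A :=
  LinearMap.mul' K (A ⊗[K] A) ∘ₗ TensorProduct.map
    (Algebra.TensorProduct.includeLeft.toLinearMap ∘ₗ antipode K) comul

variable (K A) in
/-- The map `x ⊗ y ↦ x₁ ⊗ S x₂ y`. -/
noncomputable def comulAntipodeMul : A ⊗[K] A →ₗ[K] A ⊗[K] A :=
  LinearMap.mul' K (A ⊗[K] A) ∘ₗ TensorProduct.map
    ((antipode K).lTensor A ∘ₗ comul) Algebra.TensorProduct.includeRight.toLinearMap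

theorem antipodeMulComul_tmul (x y : A) : antipodeMulComul K A (x ⊗ₜ y) =
    (antipode K x ⊗ₜ 1) * comul (R := K) y := rfl

theorem comulAntipodeMul_tmul (x y : A) : comulAntipodeMul K A (x ⊗ₜ y) =
    (antipode K).lTensor A (comul (R := K) x) * (1 ⊗ₜ y) := rfl

/-- By coassociativity the left side is S(a₁)a₂ ⊗ a₃, and S(a₁)a₂ collapses to the counit. -/
theorem antipodeMulComul_comul (a : A) : antipodeMulComul K A (comul a) = 1 ⊗ₜ a := by
  have h : ∀ z : A ⊗[K] A, antipodeMulComul K A z =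
      (LinearMap.mul' K A ∘ₗ (antipode K).rTensor A).rTensor A
        ((TensorProduct.assoc K A A A).symm (comul.lTensor A z)) := by
    intro z
    induction z with
    | zero => simp
    | add x y hx hy => simp only [map_add, hx, hy]
    | tmul x y =>
      rw [antipodeMulComul_tmul, LinearMap.lTensor_tmul]
      generalize comul (R := K) y = w
      induction w with
      | zero => simp
      | add p q hp hq => simp only [map_add, TensorProduct.tmul_add, mul_add, hp, hq]
      | tmul p q => simp
  rw [h, Coalgebra.coassoc_symm_apply, ← LinearMap.comp_apply, ← LinearMap.rTensor_comp,
    LinearMap.comp_assoc, mul_antipode_rTensor_comul, LinearMap.rTensor_comp,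
    LinearMap.comp_apply, Coalgebra.rTensor_counit_comul]
  simp

/-- Likewise a₁ ⊗ S(a₂)a₃ collapses on the right. -/
theorem comulAntipodeMul_comul (a : A) : comulAntipodeMul K A (comul a) = a ⊗ₜ 1 := by
  have h : ∀ z : A ⊗[K] A, comulAntipodeMul K A z =
      (LinearMap.mul' K A ∘ₗ (antipode K).rTensor A).lTensor A
        (TensorProduct.assoc K A A A (comul.rTensor A z)) := by
    intro z
    induction z with
    | zero => simp
    | add x y hx hy => simp only [map_add, hx, hy]
    | tmul x y =>
      rw [comulAntipodeMul_tmul, LinearMap.rTensor_tmul]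
      generalize comul (R := K) x = w
      induction w with
      | zero => simp
      | add p q hp hq => simp only [map_add, TensorProduct.add_tmul, add_mul, hp, hq]
      | tmul p q => simp
  rw [h, Coalgebra.coassoc_apply, ← LinearMap.comp_apply, ← LinearMap.lTensor_comp,
    LinearMap.comp_assoc, mul_antipode_rTensor_comul, LinearMap.lTensor_comp,
    LinearMap.comp_apply, Coalgebra.lTensor_counit_comul]
  simp

end HopfAlgebra

/-! ### Hopf subalgebras with epimorphic inclusion. -/

/-- An element of `(X₀ ⊗ Y) ∩ (X ⊗ Y₀)` is in `X₀ ⊗ Y₀`. -/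
theorem TensorProduct.mem_range_map_subtype {K X Y : Type*} [Field K] [AddCommGroup X] [Module K X]
    [AddCommGroup Y] [Module K Y] (X₀ : Submodule K X) (Y₀ : Submodule K Y) (w : X ⊗[K] Y)
    (h₁ : w ∈ LinearMap.range (X₀.subtype.rTensor Y))
    (h₂ : w ∈ LinearMap.range (Y₀.subtype.lTensor X)) :
    w ∈ LinearMap.range (TensorProduct.map X₀.subtype Y₀.subtype) := by
  obtain ⟨w', rfl⟩ := h₁
  obtain ⟨v, hv⟩ := h₂
  have hex : Function.Exact Y₀.subtype Y₀.mkQ := LinearMap.exact_subtype_mkQ Y₀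
  have h0 : Y₀.mkQ.lTensor X (X₀.subtype.rTensor Y w') = 0 := by
    rw [← hv]
    exact (lTensor_exact X hex Y₀.mkQ_surjective).apply_apply_eq_zero v
  -- The image of w vanishes in X ⊗ Y/Y₀. Flatness makes X₀ ⊗ Y/Y₀ → X ⊗ Y/Y₀ injective, so it
  -- already vanishes in X₀ ⊗ Y/Y₀.
  have h1 : X₀.subtype.rTensor (Y ⧸ Y₀) (Y₀.mkQ.lTensor X₀ w') = 0 := by
    rw [← h0, ← LinearMap.comp_apply, ← LinearMap.comp_apply, LinearMap.rTensor_comp_lTensor,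
      LinearMap.lTensor_comp_rTensor]
  have h2 : Y₀.mkQ.lTensor X₀ w' = 0 :=
    Module.Flat.rTensor_preserves_injective_linearMap X₀.subtype X₀.injective_subtype
      (by rw [h1, map_zero])
  obtain ⟨u, rfl⟩ := (lTensor_exact X₀ hex Y₀.mkQ_surjective w').mp h2
  exact ⟨u, by rw [← LinearMap.comp_apply, LinearMap.rTensor_comp_lTensor]⟩

theorem TensorProduct.mem_of_tmul_mem_range_lTensor {K X Y : Type*} [Field K] [AddCommGroup X]
    [Module K X] [AddCommGroup Y] [Module K Y] (Y₀ : Submodule K Y) {x : X} (hx : x ≠ 0) {y : Y}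
    (h : x ⊗ₜ[K] y ∈ LinearMap.range (Y₀.subtype.lTensor X)) : y ∈ Y₀ := by
  obtain ⟨f, hf⟩ := Module.Projective.exists_dual_eq_one K hx
  obtain ⟨z, hz⟩ := h
  have h1 := congrArg (TensorProduct.lid K Y ∘ f.rTensor Y) hz
  simp only [Function.comp_apply, LinearMap.rTensor_tmul, TensorProduct.lid_tmul, hf,
    one_smul] at h1
  rw [← h1]
  clear h1 hz
  induction z with
  | zero => simp
  | add p q hp hq => simp only [map_add]; exact add_mem hp hq
  | tmul p q => simpa using Y₀.smul_mem _ q.2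

/-- A Hopf subalgebra whose inclusion is an epimorphism of rings is the whole algebra. -/
theorem Subalgebra.eq_top_of_isEpi {K A : Type*} [Field K] [CommRing A] [HopfAlgebra K A]
    [IsReduced A] (A₀ : Subalgebra K A)
    (hΔ : ∀ a ∈ A₀, Coalgebra.comul (R := K) a ∈
      LinearMap.range (TensorProduct.map A₀.toSubmodule.subtype A₀.toSubmodule.subtype))
    (hS : ∀ a ∈ A₀, HopfAlgebra.antipode K a ∈ A₀) [Algebra.IsEpi A₀ A] : A₀ = ⊤ := by
  have : Nontrivial A := Bialgebra.nontrivial (R := K)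
  have : IsReduced A₀ := isReduced_of_injective A₀.val Subtype.val_injective
  refine eq_top_iff.mpr fun a _ => ?_
  classical
  let R := Coalgebra.Repr.arbitrary K a
  -- A common denominator s for all the right tensor factors a₂ of Δa.
  obtain ⟨s, hs0, hs⟩ := Algebra.IsEpi.exists_ne_zero_smul_mem_range (R := A₀)
    (R.index.image R.right)
  -- `w` is `s₁ ⊗ s₂ a`
  let w : A ⊗[K] A := Coalgebra.comul (R := K) (s : A) * (1 ⊗ₜ a)
  -- Expanding 1 ⊗ a as (S(a₁) ⊗ 1)Δ(a₂) absorbs s into a₂. As s a₂ ∈ A₀, this puts w in A ⊗ A₀,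
  -- while Δs ∈ A₀ ⊗ A₀ puts it in A₀ ⊗ A.
  have hw : w = ∑ j ∈ R.index,
      (HopfAlgebra.antipode K (R.left j) ⊗ₜ 1) * Coalgebra.comul (R := K) (s * R.right j) := by
    simp only [w]
    rw [← HopfAlgebra.antipodeMulComul_comul, ← R.eq, map_sum, Finset.mul_sum]
    refine Finset.sum_congr rfl fun j _ => ?_
    rw [HopfAlgebra.antipodeMulComul_tmul, Bialgebra.comul_mul, mul_left_comm]
  have hw₂ : w ∈ LinearMap.range (A₀.toSubmodule.subtype.lTensor A) := by
    rw [hw]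
    refine sum_mem fun j hj => ?_
    obtain ⟨b, hb⟩ := hs _ (Finset.mem_image_of_mem _ hj)
    obtain ⟨z, hz⟩ := hΔ (s * R.right j) (by
      have : (s : A) * R.right j = b := hb
      exact this ▸ b.2)
    rw [← hz]
    clear hz
    induction z with
    | zero => simp
    | add p q hp hq => rw [map_add, mul_add]; exact add_mem hp hq
    | tmul p q => exact ⟨(HopfAlgebra.antipode K (R.left j) * p) ⊗ₜ q, by simp⟩
  have hw₁ : w ∈ LinearMap.range (A₀.toSubmodule.subtype.rTensor A) := by
    obtain ⟨z, hz⟩ := hΔ s s.2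
    simp only [w]
    rw [← hz]
    clear hz
    induction z with
    | zero => simp
    | add p q hp hq => rw [map_add, add_mul]; exact add_mem hp hq
    | tmul p q => exact ⟨p ⊗ₜ (q * a), by simp⟩
  obtain ⟨z, hz⟩ := TensorProduct.mem_range_map_subtype _ _ w hw₁ hw₂
  have h₁ : HopfAlgebra.comulAntipodeMul K A w = (s : A) ⊗ₜ a := by
    have : ∀ v : A ⊗[K] A, HopfAlgebra.comulAntipodeMul K A (v * (1 ⊗ₜ a)) =
        HopfAlgebra.comulAntipodeMul K A v * (1 ⊗ₜ a) := by
      intro v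
      induction v with
      | zero => simp
      | add p q hp hq => simp only [add_mul, map_add, hp, hq]
      | tmul p q => simp [HopfAlgebra.comulAntipodeMul_tmul, mul_assoc]
    rw [this, HopfAlgebra.comulAntipodeMul_comul]
    simp
  -- The map x ⊗ y ↦ x₁ ⊗ S(x₂)y sends A₀ ⊗ A₀ into A ⊗ A₀ and w to s ⊗ a; since s ≠ 0, this forces
  -- a ∈ A₀.
  refine TensorProduct.mem_of_tmul_mem_range_lTensor A₀.toSubmodule (x := (s : A))
    (fun h => hs0 (Subtype.ext h)) ?_
  rw [← h₁, ← hz]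
  clear hz
  induction z with
  | zero => simp
  | add p q hp hq => simp only [map_add]; exact add_mem hp hq
  | tmul p q =>
    obtain ⟨y, hy⟩ := hΔ p p.2
    simp only [TensorProduct.map_tmul, HopfAlgebra.comulAntipodeMul_tmul, Submodule.subtype_apply]
    rw [← hy]
    clear hy
    induction y with
    | zero => simp
    | add b c hb hc => simp only [map_add, add_mul]; exact add_mem hb hc
    | tmul b c =>
      exact ⟨(b : A) ⊗ₜ ⟨_, A₀.mul_mem (hS c c.2) q.2⟩, by simp⟩

namespace DiffAlgGroup

/-- The differential ring structure given by an additive map satisfying the Leibniz rule. -/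
abbrev differentialOfLeibniz {R : Type*} [CommRing R] (f : R →+ R)
    (hf : ∀ x y, f (x * y) = x * f y + y * f x) : Differential R :=
  ⟨Derivation.mk' f.toIntLinearMap hf⟩

/-! ### Differential subalgebras -/

section DiffAdjoin

variable {K A : Type*} [Field K] [CommRing A] [Algebra K A] [Differential A]

variable (K) in
/-- The differential subalgebra generated by a set. -/
def diffAdjoin (s : Set A) : Subalgebra K A :=
  Algebra.adjoin K {x : A | ∃ a ∈ s, ∃ i : ℕ, x = (fun a : A => a′)^[i] a}

theorem subset_diffAdjoin (s : Set A) : s ⊆ diffAdjoin K s :=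
  fun a ha => Algebra.subset_adjoin ⟨a, ha, 0, rfl⟩

theorem diffAdjoin_le {s : Set A} {Q : Subalgebra K A} (hs : s ⊆ Q) (hQ : ∀ x ∈ Q, x′ ∈ Q) :
    diffAdjoin K s ≤ Q := by
  refine Algebra.adjoin_le ?_
  rintro _ ⟨a, ha, i, rfl⟩
  induction i with
  | zero => exact hs ha
  | succ i ih => rw [Function.iterate_succ_apply']; exact hQ _ ih

theorem deriv_mem_adjoin [Differential K] [DifferentialAlgebra K A] {s : Set A}
    (hs : ∀ a ∈ s, a′ ∈ Algebra.adjoin K s) {x : A} (hx : x ∈ Algebra.adjoin K s) :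
    x′ ∈ Algebra.adjoin K s := by
  induction hx using Algebra.adjoin_induction with
  | mem x hx => exact hs x hx
  | algebraMap c => rw [deriv_algebraMap]; exact Subalgebra.algebraMap_mem _ _
  | add x y _ _ hx hy => rw [map_add]; exact add_mem hx hy
  | mul x y hx hy hx' hy' =>
    rw [Derivation.leibniz, smul_eq_mul, smul_eq_mul]
    exact add_mem (mul_mem hx hy') (mul_mem hy hx')

theorem deriv_mem_diffAdjoin [Differential K] [DifferentialAlgebra K A] {s : Set A} {x : A}
    (hx : x ∈ diffAdjoin K s) : x′ ∈ diffAdjoin K s := by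
  refine deriv_mem_adjoin ?_ hx
  rintro _ ⟨a, ha, i, rfl⟩
  exact Algebra.subset_adjoin ⟨a, ha, i + 1, by rw [Function.iterate_succ_apply']⟩

end DiffAdjoin

/-! ### Matrix coefficients -/

/-- A matrix `g` over a Hopf algebra satisfying `Δ g = g ⊗ g` and `ε g = 1`. -/
structure IsMultiplicativeMatrix (K : Type*) {A n : Type*} [Field K] [CommRing A] [HopfAlgebra K A]
    [Fintype n] [DecidableEq n] (g : Matrix n n A) : Prop where
  comul : ∀ i j, Coalgebra.comul (R := K) (g i j) = ∑ k, g i k ⊗ₜ[K] g k j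
  counit : ∀ i j, Coalgebra.counit (R := K) (g i j) = (1 : Matrix n n K) i j

namespace IsMultiplicativeMatrix

variable {K A n : Type*} [Field K] [CommRing A] [HopfAlgebra K A] [Fintype n] [DecidableEq n]
  {g : Matrix n n A}

theorem map_antipode_mul (hg : IsMultiplicativeMatrix K g) :
    g.map (HopfAlgebra.antipode K) * g = 1 := by
  ext i j
  have h := HopfAlgebra.mul_antipode_rTensor_comul_apply (R := K) (g i j)
  rw [hg.comul, hg.counit] at h
  simp only [map_sum, LinearMap.rTensor_tmul, LinearMap.mul'_apply] at h
  rw [Matrix.mul_apply]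
  simp only [Matrix.map_apply, h, Matrix.one_apply]
  split_ifs <;> simp

theorem antipode_det_mul_det (hg : IsMultiplicativeMatrix K g) :
    HopfAlgebra.antipode K g.det * g.det = 1 := by
  have h : HopfAlgebra.antipode K g.det = (g.map (HopfAlgebra.antipode K)).det :=
    (HopfAlgebra.antipodeAlgHom K A).map_det g
  rw [h, ← Matrix.det_mul, hg.map_antipode_mul, Matrix.det_one]

/-- Both S(S(det g)) and det g are inverse to S(det g). -/
theorem antipode_antipode_det (hg : IsMultiplicativeMatrix K g) :
    HopfAlgebra.antipode K (HopfAlgebra.antipode K g.det) = g.det := by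
  have h := congrArg (HopfAlgebra.antipode K) hg.antipode_det_mul_det
  rw [HopfAlgebra.antipode_mul_distrib, HopfAlgebra.antipode_one] at h
  calc _ = HopfAlgebra.antipode K (HopfAlgebra.antipode K g.det) *
        (HopfAlgebra.antipode K g.det * g.det) := by rw [hg.antipode_det_mul_det, mul_one]
    _ = g.det := by rw [← mul_assoc, h, one_mul]

/-- Cramer's rule for S(g) = g⁻¹: the antipode of an entry is a polynomial in the entries and the
inverse determinant. -/
theorem antipode_apply (hg : IsMultiplicativeMatrix K g) (i j : n) :
    HopfAlgebra.antipode K (g i j) = HopfAlgebra.antipode K g.det * g.adjugate i j := by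
  have h : g.map (HopfAlgebra.antipode K) = HopfAlgebra.antipode K g.det • g.adjugate := by
    calc _ = g.map (HopfAlgebra.antipode K) *
          (HopfAlgebra.antipode K g.det • (g * g.adjugate)) := by
          rw [Matrix.mul_adjugate, smul_smul, hg.antipode_det_mul_det, one_smul, mul_one]
      _ = _ := by
          rw [Matrix.mul_smul, ← mul_assoc, hg.map_antipode_mul, one_mul]
  exact congrFun (congrFun h i) j

/-- Take determinants in the matrix identity Δ(g) = (g ⊗ 1)(1 ⊗ g). -/
theorem comul_det (hg : IsMultiplicativeMatrix K g) :
    Coalgebra.comul (R := K) g.det = g.det ⊗ₜ g.det := by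
  have h : (g.map (Bialgebra.comulAlgHom K A)) =
      g.map (Algebra.TensorProduct.includeLeft : A →ₐ[K] A ⊗[K] A) *
        g.map (Algebra.TensorProduct.includeRight : A →ₐ[K] A ⊗[K] A) := by
    ext i j
    simp [Matrix.mul_apply, hg.comul]
  have h2 := (Bialgebra.comulAlgHom K A).map_det g
  rw [AlgHom.mapMatrix_apply, h, Matrix.det_mul, ← AlgHom.mapMatrix_apply,
    ← AlgHom.mapMatrix_apply, ← AlgHom.map_det, ← AlgHom.map_det] at h2
  simpa using h2

theorem comul_antipode_det (hg : IsMultiplicativeMatrix K g) :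
    Coalgebra.comul (R := K) (HopfAlgebra.antipode K g.det) =
      HopfAlgebra.antipode K g.det ⊗ₜ HopfAlgebra.antipode K g.det := by
  set d := HopfAlgebra.antipode K g.det
  have h : Coalgebra.comul (R := K) d * (g.det ⊗ₜ g.det) = 1 := by
    rw [← hg.comul_det, ← Bialgebra.comul_mul, hg.antipode_det_mul_det, Bialgebra.comul_one]
  have h2 : (g.det ⊗ₜ[K] g.det) * (d ⊗ₜ d) = 1 := by
    rw [Algebra.TensorProduct.tmul_mul_tmul, mul_comm, hg.antipode_det_mul_det,
      Algebra.TensorProduct.one_def]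
  exact left_inv_eq_right_inv h h2

theorem counit_antipode_det (hg : IsMultiplicativeMatrix K g) :
    Coalgebra.counit (R := K) (HopfAlgebra.antipode K g.det) = 1 := by
  have h : (g.map (Bialgebra.counitAlgHom K A)) = 1 := by
    ext i j
    simp [hg.counit]
  have h2 := (Bialgebra.counitAlgHom K A).map_det g
  rw [AlgHom.mapMatrix_apply, h, Matrix.det_one] at h2
  rw [HopfAlgebra.counit_antipode]
  exact h2

/-- The entries of a matrix and the inverse of its determinant. -/
def coordinates (K : Type*) {A n : Type*} [Field K] [CommRing A] [HopfAlgebra K A]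
    [Fintype n] [DecidableEq n] (g : Matrix n n A) : Set A :=
  insert (HopfAlgebra.antipode K g.det) (Set.range fun p : n × n => g p.1 p.2)

theorem apply_mem_coordinates (g : Matrix n n A) (i j : n) : g i j ∈ coordinates K g :=
  Or.inr ⟨(i, j), rfl⟩

theorem antipode_det_mem_coordinates (g : Matrix n n A) :
    HopfAlgebra.antipode K g.det ∈ coordinates K g := Or.inl rfl

theorem det_mem {Q : Type*} [SetLike Q A] [SubringClass Q A] {q : Q} {g : Matrix n n A}
    (hq : ∀ i j, g i j ∈ q) : g.det ∈ q := by
  rw [Matrix.det_apply]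
  exact sum_mem fun σ _ => zsmul_mem (prod_mem fun i _ => hq _ _) _

/-- Follows from Cramer's rule. Arbitrary subrings are allowed because it is applied to subalgebras
over the base field and to subalgebras over a smaller field. -/
theorem antipode_mem (hg : IsMultiplicativeMatrix K g) {Q : Type*} [SetLike Q A]
    [SubringClass Q A] {q : Q} (hq : coordinates K g ⊆ q) {a : A} (ha : a ∈ coordinates K g) :
    HopfAlgebra.antipode K a ∈ q := by
  have h : ∀ i j, g i j ∈ q := fun i j => hq (apply_mem_coordinates g i j)
  rcases ha with rfl | ⟨⟨i, j⟩, rfl⟩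
  · rw [hg.antipode_antipode_det]
    exact det_mem h
  · simp only [hg.antipode_apply]
    refine mul_mem (hq (antipode_det_mem_coordinates g)) ?_
    rw [Matrix.adjugate_apply]
    refine det_mem fun k l => ?_
    rw [Matrix.updateRow_apply]
    split_ifs
    · rw [Pi.single_apply]
      split_ifs
      · exact one_mem q
      · exact zero_mem q
    · exact h k l

end IsMultiplicativeMatrix

theorem tensorDeriv_tmul {K S T : Type u} [Field K] [Differential K] [CommRing S]
    [Differential S] [Algebra K S] [DifferentialAlgebra K S] [CommRing T] [Differential T]
    [Algebra K T] [DifferentialAlgebra K T] (s : S) (t : T) :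
    tensorDeriv K S T (s ⊗ₜ t) = s′ ⊗ₜ t + s ⊗ₜ t′ := rfl

/-! ### The derivation on a tensor square over a differential ring. -/

section

variable (R S : Type*) [CommRing R] [Differential R] [CommRing S] [Differential S] [Algebra R S]
  [DifferentialAlgebra R S]

/-- The additive map `x ⊗ y ↦ x′ ⊗ y + x ⊗ y′`. -/
noncomputable def leibnizMap : S ⊗[R] S →+ S ⊗[R] S :=
  TensorProduct.liftAddHom
    (AddMonoidHom.mk' (fun x => AddMonoidHom.mk' (fun y => x′ ⊗ₜ[R] y + x ⊗ₜ[R] y′)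
        (by intro a b; simp only [map_add, TensorProduct.tmul_add]; abel))
      (by
        intro a b
        ext y
        simp only [AddMonoidHom.mk'_apply, AddMonoidHom.add_apply, map_add, TensorProduct.add_tmul]
        abel))
    (by
      intro c x y
      have h : ∀ z : S, (c • z)′ = c • z′ + c′ • z := by
        intro z
        simp [Algebra.smul_def, deriv_algebraMap, mul_comm, add_comm]
      simp only [AddMonoidHom.mk'_apply, h, TensorProduct.add_tmul, TensorProduct.tmul_add,
        TensorProduct.tmul_smul, TensorProduct.smul_tmul']
      abel)

theorem leibnizMap_tmul (x y : S) : leibnizMap R S (x ⊗ₜ y) = x′ ⊗ₜ y + x ⊗ₜ y′ := rfl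

theorem leibnizMap_mul (p q : S ⊗[R] S) :
    leibnizMap R S (p * q) = p * leibnizMap R S q + q * leibnizMap R S p := by
  induction p with
  | zero => simp
  | add p₁ p₂ h₁ h₂ => simp only [add_mul, mul_add, map_add, h₁, h₂]; abel
  | tmul a b =>
    induction q with
    | zero => simp
    | add q₁ q₂ h₁ h₂ => simp only [add_mul, mul_add, map_add, h₁, h₂]; abel
    | tmul c d =>
      simp only [Algebra.TensorProduct.tmul_mul_tmul, leibnizMap_tmul, Derivation.leibniz,
        smul_eq_mul, TensorProduct.add_tmul, TensorProduct.tmul_add, mul_add]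
      simp only [mul_comm c, mul_comm d]
      abel

end

/-! ### Faithful representations generate the coordinate ring -/

namespace DiffRep

section Coeff

variable {K A V : Type u} [Field K] [CommRing A] [HopfAlgebra K A] [AddCommGroup V] [Module K V]
  {n : Type*} [Fintype n]

/-- The matrix coefficients of a representation with respect to a basis. -/
noncomputable def coeff (r : DiffRep K A V) (b : Module.Basis n K V) : Matrix n n A :=
  fun i j => TensorProduct.lid K A ((b.coord i).rTensor A (r.coact (b j)))

theorem coact_basis (r : DiffRep K A V) (b : Module.Basis n K V) (j : n) :
    r.coact (b j) = ∑ i, b i ⊗ₜ r.coeff b i j := by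
  have h : ∀ z : V ⊗[K] A,
      z = ∑ i, b i ⊗ₜ TensorProduct.lid K A ((b.coord i).rTensor A z) := by
    intro z
    induction z with
    | zero => simp
    | add x y hx hy =>
      simp only [map_add, TensorProduct.tmul_add, Finset.sum_add_distrib, ← hx, ← hy]
    | tmul v a =>
      conv_lhs => rw [← b.sum_repr v, TensorProduct.sum_tmul]
      simp [TensorProduct.smul_tmul]
  exact h _

/-- Coassociativity and the counit axiom at b j, read off on the coordinate b i. -/
theorem isMultiplicativeMatrix_coeff [DecidableEq n] (r : DiffRep K A V)
    (b : Module.Basis n K V) : IsMultiplicativeMatrix K (r.coeff b) where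
  comul i j := by
    have h := r.coassoc (b j)
    rw [r.coact_basis b] at h
    simp only [map_sum, LinearMap.rTensor_tmul, r.coact_basis b, LinearMap.lTensor_tmul,
      TensorProduct.sum_tmul, TensorProduct.assoc_tmul] at h
    have h2 := congrArg (TensorProduct.lid K (A ⊗[K] A) ∘ (b.coord i).rTensor (A ⊗[K] A)) h
    simp only [Function.comp_apply, map_sum, LinearMap.rTensor_tmul, TensorProduct.lid_tmul,
      Module.Basis.coord_apply, Module.Basis.repr_self, Finsupp.single_apply, ite_smul, one_smul,
      zero_smul, Finset.sum_ite_eq', Finset.mem_univ, if_true] at h2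
    exact h2.symm
  counit i j := by
    have h := r.counit (b j)
    rw [r.coact_basis b] at h
    have h2 := congrArg (b.coord i) h
    simp only [map_sum, LinearMap.lTensor_tmul, TensorProduct.rid_tmul, map_smul,
      Module.Basis.coord_apply, Module.Basis.repr_self, Finsupp.single_apply, smul_eq_mul,
      mul_ite, mul_one, mul_zero, Finset.sum_ite_eq', Finset.mem_univ, if_true] at h2
    rw [h2, Matrix.one_apply]
    simp [eq_comm]

end Coeff

variable {K A V : Type u} [Field K] [Differential K] [CommRing A] [HopfAlgebra K A]
  [Differential A] [DifferentialAlgebra K A] [AddCommGroup V] [Module K V]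
  {n : Type*} [Fintype n]

/-- A differential subalgebra containing the matrix coefficients of a faithful representation has
an epimorphic inclusion. -/
theorem IsFaithful.isEpi {r : DiffRep K A V} (hr : r.IsFaithful) (b : Module.Basis n K V)
    (A₀ : Subalgebra K A) (h₀ : ∀ x ∈ A₀, x′ ∈ A₀) (hb : ∀ i j, r.coeff b i j ∈ A₀) :
    Algebra.IsEpi A₀ A := by
  rw [Algebra.isEpi_iff_forall_one_tmul_eq]
  intro a
  let _ : Differential A₀ := differentialOfLeibniz
    (AddMonoidHom.mk' (fun x : A₀ => (⟨(x : A)′, h₀ x x.2⟩ : A₀))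
      (fun x y => Subtype.ext (map_add _ _ _)))
    (fun x y => Subtype.ext (Derivation.leibniz _ _ _))
  have : DifferentialAlgebra A₀ A := ⟨fun _ => rfl⟩
  let _ : Differential (A ⊗[A₀] A) := 
    differentialOfLeibniz (leibnizMap A₀ A) (leibnizMap_mul A₀ A)
  have hd : ∀ x y : A, (x ⊗ₜ[A₀] y)′ = x′ ⊗ₜ y + x ⊗ₜ y′ := fun _ _ => rfl
  have : DifferentialAlgebra K (A ⊗[A₀] A) := ⟨fun c => by
    simp only [Algebra.TensorProduct.algebraMap_apply, hd, deriv_algebraMap]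
    simp⟩
  -- With the Leibniz derivation on A ⊗_{A₀} A, which exists because A₀ is ∂-stable, the two
  -- inclusions of A are points of the group. The matrix coefficients lie in A₀, so the inclusions
  -- agree on them, and faithfulness makes the two points equal.
  let g₁ : Points K A (A ⊗[A₀] A) := ⟨(Algebra.TensorProduct.includeLeft : A →ₐ[K] A ⊗[A₀] A),
    fun a => by simp [hd]⟩
  let g₂ : Points K A (A ⊗[A₀] A) :=
    ⟨(Algebra.TensorProduct.includeRight : A →ₐ[A₀] A ⊗[A₀] A).restrictScalars K,
      fun a => by simp [hd]⟩
  have h : g₁ = g₂ := by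
    apply hr
    refine b.ext fun j => ?_
    simp only [act, LinearMap.comp_apply, r.coact_basis b, map_sum, LinearMap.lTensor_tmul]
    refine Finset.sum_congr rfl fun i _ => ?_
    congr 1
    change r.coeff b i j ⊗ₜ[A₀] (1 : A) = 1 ⊗ₜ r.coeff b i j
    have h1 := TensorProduct.smul_tmul (R := A₀) (⟨_, hb i j⟩ : A₀) (1 : A) (1 : A)
    simpa [Subalgebra.smul_def] using h1
  exact (DFunLike.congr_fun (congrArg Subtype.val h) a).symm

/-- Since Δ and S commute with ∂, stability of the differential subalgebra under them need only be
checked on the coordinates. The inverse determinant is included to make it stable under S. It is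
then a Hopf subalgebra with epimorphic inclusion, hence everything. -/
theorem IsFaithful.diffAdjoin_coordinates [DiffHopfAlgebra K A] [IsReduced A] [DecidableEq n]
    {r : DiffRep K A V} (hr : r.IsFaithful) (b : Module.Basis n K V) :
    diffAdjoin K (IsMultiplicativeMatrix.coordinates K (r.coeff b)) = ⊤ := by
  have hg := r.isMultiplicativeMatrix_coeff b
  set g := r.coeff b
  set A₀ := diffAdjoin K (IsMultiplicativeMatrix.coordinates K g)
  have hg₀ : ∀ i j, g i j ∈ A₀ := fun i j =>
    subset_diffAdjoin _ (IsMultiplicativeMatrix.apply_mem_coordinates g i j)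
  have hd₀ : HopfAlgebra.antipode K g.det ∈ A₀ :=
    subset_diffAdjoin _ (IsMultiplicativeMatrix.antipode_det_mem_coordinates g)
  have h₀ : ∀ x ∈ A₀, x′ ∈ A₀ := fun x => deriv_mem_diffAdjoin
  have := hr.isEpi b A₀ h₀ hg₀
  refine Subalgebra.eq_top_of_isEpi A₀ ?_ ?_
  · let R₂ : Subalgebra K (A ⊗[K] A) := (Algebra.TensorProduct.map A₀.val A₀.val).range
    have hR₂ : ∀ z ∈ R₂, tensorDeriv K A A z ∈ R₂ := by
      rintro _ ⟨z, rfl⟩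
      induction z with
      | zero => simp
      | add x y hx hy => simp only [map_add] at hx hy ⊢; exact add_mem hx hy
      | tmul x y =>
        refine ⟨(⟨_, h₀ x x.2⟩ : A₀) ⊗ₜ y + x ⊗ₜ (⟨_, h₀ y y.2⟩ : A₀), ?_⟩
        simp [tensorDeriv_tmul]
    have htmul : ∀ {x y : A}, x ∈ A₀ → y ∈ A₀ → x ⊗ₜ[K] y ∈ R₂ := fun {x y} hx hy =>
      ⟨(⟨x, hx⟩ : A₀) ⊗ₜ (⟨y, hy⟩ : A₀), by simp⟩
    have hle : A₀ ≤ R₂.comap (Bialgebra.comulAlgHom K A) := by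
      refine diffAdjoin_le ?_ ?_
      · rintro _ (rfl | ⟨⟨i, j⟩, rfl⟩)
        · change Coalgebra.comul (R := K) (HopfAlgebra.antipode K g.det) ∈ R₂
          rw [hg.comul_antipode_det]
          exact htmul hd₀ hd₀
        · change Coalgebra.comul (R := K) (g i j) ∈ R₂
          rw [hg.comul]
          exact sum_mem fun k _ => htmul (hg₀ _ _) (hg₀ _ _)
      · intro x hx
        change Coalgebra.comul (R := K) x′ ∈ R₂
        rw [DiffHopfAlgebra.comul_deriv]
        exact hR₂ _ hx
    intro a ha
    obtain ⟨z, hz⟩ := hle ha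
    exact ⟨z, hz⟩
  · have hle : A₀ ≤ A₀.comap (HopfAlgebra.antipodeAlgHom K A) := by
      refine diffAdjoin_le (fun a ha => hg.antipode_mem (subset_diffAdjoin _) ha) ?_
      intro x hx
      change HopfAlgebra.antipode K x′ ∈ A₀
      rw [DiffHopfAlgebra.antipode_deriv]
      exact h₀ _ hx
    exact fun a ha => hle ha

end DiffRep

theorem _root_.TrivSqZeroExt.fst_inl_add_inr {R : Type*} [CommRing R] (a b : R) :
    (TrivSqZeroExt.inl a + TrivSqZeroExt.inr b : TrivSqZeroExt R R).fst = a := by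
  rw [TrivSqZeroExt.fst_add, TrivSqZeroExt.fst_inl, TrivSqZeroExt.fst_inr, add_zero]

theorem _root_.TrivSqZeroExt.snd_inl_add_inr {R : Type*} [CommRing R] (a b : R) :
    (TrivSqZeroExt.inl a + TrivSqZeroExt.inr b : TrivSqZeroExt R R).snd = b := by
  rw [TrivSqZeroExt.snd_add, TrivSqZeroExt.snd_inl, TrivSqZeroExt.snd_inr, zero_add]

/-! ### Linear differential equations over differentially closed fields -/

section Fundamental

/-! ### Derivations on a field of rational functions, via dual numbers. -/

section Taylor

variable {F L : Type*} [Field F] {n : ℕ} [Field L]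
  [Algebra (MvPolynomial (Fin n × Fin n) F) L]

variable (F L n) in
/-- The generic matrix, over the field `L` of rational functions in its entries. -/
noncomputable def genericMatrix : Matrix (Fin n) (Fin n) L :=
  (Matrix.mvPolynomialX (Fin n) (Fin n) F).map (algebraMap _ _)

theorem det_genericMatrix_ne_zero [IsFractionRing (MvPolynomial (Fin n × Fin n) F) L] :
    (genericMatrix F L n).det ≠ 0 := by
  have h := (algebraMap (MvPolynomial (Fin n × Fin n) F) L).map_det
    (Matrix.mvPolynomialX (Fin n) (Fin n) F)
  rw [genericMatrix, ← RingHom.mapMatrix_apply, ← h]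
  exact (map_ne_zero_iff _ (IsFractionRing.injective _ _)).mpr
    (Matrix.det_mvPolynomialX_ne_zero (Fin n) F)

variable [Algebra F L] [IsScalarTower F (MvPolynomial (Fin n × Fin n) F) L] [Differential F]

variable (F L) in
/-- The first-order Taylor homomorphism on the coefficients. -/
noncomputable def coeffTaylor : F →+* TrivSqZeroExt L L where
  toFun c := TrivSqZeroExt.inl (algebraMap F L c) + TrivSqZeroExt.inr (algebraMap F L c′)
  map_one' := by
    rw [map_one, Derivation.map_one_eq_zero, map_zero, TrivSqZeroExt.inr_zero, add_zero,
      TrivSqZeroExt.inl_one]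
  map_zero' := by
    rw [map_zero, map_zero, map_zero, TrivSqZeroExt.inr_zero, add_zero, TrivSqZeroExt.inl_zero]
  map_add' x y := by
    rw [map_add, map_add, map_add, TrivSqZeroExt.inl_add, TrivSqZeroExt.inr_add]
    abel
  map_mul' x y := TrivSqZeroExt.ext
    (by simp only [TrivSqZeroExt.fst_mul, TrivSqZeroExt.fst_inl_add_inr, map_mul])
    (by simp only [TrivSqZeroExt.snd_mul, TrivSqZeroExt.fst_inl_add_inr,
          TrivSqZeroExt.snd_inl_add_inr, Derivation.leibniz, map_add, smul_eq_mul, map_mul,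
          MulOpposite.smul_eq_mul_unop, MulOpposite.unop_op, mul_comm (algebraMap F L y)])

variable (F) in
/-- The first-order Taylor homomorphism on polynomials in the entries `X` of a generic matrix with
`X′ = M`. -/
noncomputable def polyTaylor (M : Matrix (Fin n) (Fin n) L) :
    MvPolynomial (Fin n × Fin n) F →+* TrivSqZeroExt L L :=
  MvPolynomial.eval₂Hom (coeffTaylor F L)
    (fun p => TrivSqZeroExt.inl (genericMatrix F L n p.1 p.2) + TrivSqZeroExt.inr (M p.1 p.2))

theorem fst_polyTaylor (M : Matrix (Fin n) (Fin n) L)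
    (f : MvPolynomial (Fin n × Fin n) F) :
    (polyTaylor F M f).fst = algebraMap _ L f := by
  have h : (TrivSqZeroExt.fstHom L L L).toRingHom.comp (polyTaylor F M) = algebraMap _ L := by
    refine MvPolynomial.ringHom_ext (fun c => ?_) (fun p => ?_)
    · rw [← MvPolynomial.algebraMap_eq, ← IsScalarTower.algebraMap_apply]
      simp [polyTaylor, coeffTaylor, MvPolynomial.algebraMap_eq]
    · simp [polyTaylor, genericMatrix]
  exact congrArg (fun g => g f) h

variable [IsFractionRing (MvPolynomial (Fin n × Fin n) F) L]

variable (F) in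
/-- The first-order Taylor homomorphism on rational functions in the entries `X` of a generic
matrix with `X′ = M`. -/
noncomputable def fieldTaylor (M : Matrix (Fin n) (Fin n) L) : L →+* TrivSqZeroExt L L :=
  IsLocalization.lift (M := nonZeroDivisors (MvPolynomial (Fin n × Fin n) F)) (g := polyTaylor F M)
    (fun y => by
      -- A dual number is a unit as soon as its constant term is, so the homomorphism extends to
      -- fractions.
      rw [TrivSqZeroExt.isUnit_iff_isUnit_fst, fst_polyTaylor]
      exact IsLocalization.map_units _ y)

theorem fieldTaylor_algebraMap (M : Matrix (Fin n) (Fin n) L)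
    (f : MvPolynomial (Fin n × Fin n) F) :
    fieldTaylor F M (algebraMap _ _ f) = polyTaylor F M f :=
  IsLocalization.lift_eq _ _

theorem fst_fieldTaylor (M : Matrix (Fin n) (Fin n) L) (x : L) :
    (fieldTaylor F M x).fst = x := by
  have h : (TrivSqZeroExt.fstHom L L L).toRingHom.comp (fieldTaylor F M) = RingHom.id L := by
    refine IsLocalization.ringHom_ext (nonZeroDivisors (MvPolynomial (Fin n × Fin n) F)) ?_
    refine RingHom.ext fun f => ?_
    simp [fieldTaylor_algebraMap, fst_polyTaylor]
  exact congrArg (fun g => g x) h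

variable (F) in
/-- The derivation on rational functions in the entries `X` of a generic matrix with `X′ = M`. -/
noncomputable abbrev genericDifferential (M : Matrix (Fin n) (Fin n) L) : Differential L :=
  differentialOfLeibniz
    (AddMonoidHom.mk' (fun x => (fieldTaylor F M x).snd) (fun x y => by simp))
    -- For a ring homomorphism x ↦ x + x′ε, multiplicativity is the Leibniz rule.
    (fun x y => by simp [fst_fieldTaylor, mul_comm])

theorem genericDifferential_algebraMap (M : Matrix (Fin n) (Fin n) L) (c : F) :
    (genericDifferential F M).deriv (algebraMap F L c) = algebraMap F L c′ := by
  change (fieldTaylor F M (algebraMap F L c)).snd = _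
  rw [IsScalarTower.algebraMap_apply F (MvPolynomial (Fin n × Fin n) F) L,
    fieldTaylor_algebraMap, MvPolynomial.algebraMap_eq, polyTaylor, MvPolynomial.coe_eval₂Hom,
    MvPolynomial.eval₂_C]
  exact TrivSqZeroExt.snd_inl_add_inr _ _

theorem genericDifferential_genericMatrix (M : Matrix (Fin n) (Fin n) L) (i j : Fin n) :
    (genericDifferential F M).deriv (genericMatrix F L n i j) = M i j := by
  change (fieldTaylor F M (algebraMap _ _ (MvPolynomial.X (i, j)))).snd = _
  rw [fieldTaylor_algebraMap, polyTaylor, MvPolynomial.coe_eval₂Hom, MvPolynomial.eval₂_X]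
  exact TrivSqZeroExt.snd_inl_add_inr _ _

end Taylor

variable {F : Type u} [Field F] [Differential F] {n : ℕ}

/-- Every linear differential system has a fundamental matrix of solutions in some differential
field extension. -/
theorem exists_extension_fundamental (β : Matrix (Fin n) (Fin n) F) :
    ∃ (L : Type u) (_ : Field L) (_ : Differential L) (_ : Algebra F L)
      (_ : DifferentialAlgebra F L) (P : Matrix (Fin n) (Fin n) L), P.det ≠ 0 ∧
        ∀ i j, (P i j)′ = -∑ k, algebraMap F L (β i k) * P k j := by
  let L := FractionRing (MvPolynomial (Fin n × Fin n) F)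
  let M : Matrix (Fin n) (Fin n) L :=
    fun i j => -∑ k, algebraMap F L (β i k) * genericMatrix F L n k j
  let _ : Differential L := genericDifferential F M
  exact ⟨L, inferInstance, inferInstance, inferInstance, ⟨genericDifferential_algebraMap M⟩,
    genericMatrix F L n, det_genericMatrix_ne_zero, genericDifferential_genericMatrix M⟩

/-- The generic matrix solves the system in an extension. Invertibility is not an equation, so it is
replaced by y · det Y = 1 with one more unknown y; the resulting finite system then has a solution
in F. -/
theorem IsDifferentiallyClosed.exists_fundamental (hF : IsDifferentiallyClosed F)
    (β : Matrix (Fin n) (Fin n) F) :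
    ∃ P : Matrix (Fin n) (Fin n) F, P.det ≠ 0 ∧ ∀ i j, (P i j)′ = -∑ k, β i k * P k j := by
  classical
  obtain ⟨L, _, _, _, _, P, hP, hP'⟩ := exists_extension_fundamental β
  -- The unknown `none` is the inverse determinant, and `some (i, j)` is a matrix entry.
  let e := Fintype.equivFin (Option (Fin n × Fin n))
  let N := Fintype.card (Option (Fin n × Fin n))
  let Y : Matrix (Fin n) (Fin n) (DiffPoly F N) := fun i j => MvPolynomial.X (e (some (i, j)), 0)
  let f : Fin n × Fin n → DiffPoly F N := fun p =>
    MvPolynomial.X (e (some p), 1) + ∑ k, MvPolynomial.C (β p.1 k) * Y k p.2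
  let d : DiffPoly F N := MvPolynomial.X (e none, 0) * Y.det - 1
  have hf : ∀ (L : Type u) [Field L] [Differential L] [Algebra F L] (a : Fin N → L)
      (p : Fin n × Fin n), DiffPoly.value L a (f p) =
        (a (e (some p)))′ + ∑ k, algebraMap F L (β p.1 k) * a (e (some (k, p.2))) := by
    intro L _ _ _ a p
    simp [DiffPoly.value, f, Y]
  have hd : ∀ (L : Type u) [Field L] [Differential L] [Algebra F L] (a : Fin N → L),
      DiffPoly.value L a d =
        a (e none) * (Matrix.of fun i j => a (e (some (i, j)))).det - 1 := by
    intro L _ _ _ a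
    simp only [DiffPoly.value, d, map_sub, map_mul, map_one, MvPolynomial.aeval_X, AlgHom.map_det,
      Function.iterate_zero_apply]
    congr 3
    ext i j
    exact MvPolynomial.aeval_X _ _
  obtain ⟨a, ha⟩ := hF N (insert d (Finset.univ.image f)) L
    ⟨fun i => (e.symm i).elim P.det⁻¹ fun p => P p.1 p.2, by
      intro g hg
      rcases Finset.mem_insert.mp hg with rfl | hg
      · rw [hd]
        simp only [Equiv.symm_apply_apply, Option.elim]
        exact sub_eq_zero.mpr (inv_mul_cancel₀ hP)
      · obtain ⟨p, -, rfl⟩ := Finset.mem_image.mp hg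
        rw [hf]
        simp [hP']⟩
  refine ⟨Matrix.of fun i j => a (e (some (i, j))), ?_, fun i j => ?_⟩
  · have h := ha d (Finset.mem_insert_self _ _)
    rw [hd] at h
    exact right_ne_zero_of_mul_eq_one (sub_eq_zero.mp h)
  · have h := ha (f (i, j)) (Finset.mem_insert_of_mem
      (Finset.mem_image_of_mem _ (Finset.mem_univ _)))
    rw [hf] at h
    exact eq_neg_of_add_eq_zero_left h

end Fundamental

/-! ### Hopf algebras generated by a matrix -/

section HopfOfMatrix

variable {C B n : Type*} [Field C] [CommRing B] [Algebra C B] [Fintype n] [DecidableEq n]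
  {x : Matrix n n B} {d : B}

/-- The bialgebra structure on an algebra generated by the entries of a matrix `x` and an element
`d`, when `x ↦ x ⊗ x` and `d ↦ d ⊗ d` extend to a homomorphism of algebras. -/
noncomputable abbrev bialgebraOfMatrix
    (hgen : Algebra.adjoin C (insert d (Set.range fun p : n × n => x p.1 p.2)) = ⊤)
    (Δ : B →ₐ[C] B ⊗[C] B) (ε : B →ₐ[C] C)
    (hΔ : ∀ i j, Δ (x i j) = ∑ k, x i k ⊗ₜ x k j) (hΔd : Δ d = d ⊗ₜ d)
    (hε : ∀ i j, ε (x i j) = (1 : Matrix n n C) i j) (hεd : ε d = 1) : Bialgebra C B :=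
  Bialgebra.ofAlgHom Δ ε
    (AlgHom.ext_of_adjoin_eq_top hgen (by
      rintro _ (rfl | ⟨⟨i, j⟩, rfl⟩)
      · simp [hΔd]
      · simp only [AlgHom.coe_comp, Function.comp_apply, hΔ, map_sum, Algebra.TensorProduct.map_tmul, AlgHom.coe_id, id_eq,
          TensorProduct.sum_tmul, TensorProduct.tmul_sum]
        exact Finset.sum_comm))
    (AlgHom.ext_of_adjoin_eq_top hgen (by
      rintro _ (rfl | ⟨⟨i, j⟩, rfl⟩)
      · simp [hΔd, hεd]
      · simp [hΔ, hε, Matrix.one_apply, TensorProduct.ite_tmul]))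
    (AlgHom.ext_of_adjoin_eq_top hgen (by
      rintro _ (rfl | ⟨⟨i, j⟩, rfl⟩)
      · simp [hΔd, hεd]
      · simp [hΔ, hε, Matrix.one_apply, TensorProduct.tmul_ite]))

/-- The Hopf algebra structure on an algebra generated by the entries of a matrix `x` and an element
`d`, when `x ↦ x ⊗ x`, `d ↦ d ⊗ d` and `x ↦ x⁻¹`, `d ↦ d⁻¹` extend to homomorphisms of algebras. -/
noncomputable abbrev hopfAlgebraOfMatrix
    (hgen : Algebra.adjoin C (insert d (Set.range fun p : n × n => x p.1 p.2)) = ⊤)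
    (Δ : B →ₐ[C] B ⊗[C] B) (ε : B →ₐ[C] C) (S : B →ₐ[C] B)
    (hΔ : ∀ i j, Δ (x i j) = ∑ k, x i k ⊗ₜ x k j) (hΔd : Δ d = d ⊗ₜ d)
    (hε : ∀ i j, ε (x i j) = (1 : Matrix n n C) i j) (hεd : ε d = 1)
    (hS : x.map S * x = 1) (hSd : S d * d = 1) : HopfAlgebra C B :=
  letI := bialgebraOfMatrix hgen Δ ε hΔ hΔd hε hεd
  HopfAlgebra.ofAlgHom S
    (AlgHom.ext_of_adjoin_eq_top hgen (by
      rintro y (hy | ⟨⟨i, j⟩, rfl⟩)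
      · rw [hy]
        change Algebra.TensorProduct.lift S (.id C B) (fun _ _ => Commute.all _ _) (Δ d) = algebraMap C B (ε d)
        simp [hΔd, hεd, hSd]
      · change Algebra.TensorProduct.lift S (.id C B) (fun _ _ => Commute.all _ _) (Δ (x i j)) = algebraMap C B (ε (x i j))
        have h := congrFun (congrFun hS i) j
        rw [Matrix.mul_apply] at h
        rw [hΔ, hε]
        simp only [Matrix.map_apply] at h
        simp only [map_sum, Algebra.TensorProduct.lift_tmul, AlgHom.coe_id, id_eq, h,
          Matrix.one_apply]
        split_ifs <;> simp))
    (AlgHom.ext_of_adjoin_eq_top hgen (by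
      rintro y (hy | ⟨⟨i, j⟩, rfl⟩)
      · rw [hy]
        change Algebra.TensorProduct.lift (.id C B) S (fun _ _ => Commute.all _ _) (Δ d) = algebraMap C B (ε d)
        simp [hΔd, hεd, mul_comm d, hSd]
      · change Algebra.TensorProduct.lift (.id C B) S (fun _ _ => Commute.all _ _) (Δ (x i j)) = algebraMap C B (ε (x i j))
        have hS' : x * x.map S = 1 := mul_eq_one_comm.mp hS
        have h := congrFun (congrFun hS' i) j
        rw [Matrix.mul_apply] at h
        rw [hΔ, hε]
        simp only [Matrix.map_apply] at h
        simp only [map_sum, Algebra.TensorProduct.lift_tmul, AlgHom.coe_id, id_eq, h,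
          Matrix.one_apply]
        split_ifs <;> simp))

end HopfOfMatrix

/-! ### Linear disjointness of constants -/

section Constants

variable {F : Type u} [Field F] [Differential F]

/-- Constants that are linearly independent over the constant field are linearly independent. -/
theorem linearIndependent_of_constants {H ι : Type*} [CommRing H] [Differential H] [Algebra F H]
    [DifferentialAlgebra F H] {v : ι → H} (hv : ∀ i, (v i)′ = 0)
    (h : LinearIndependent (constants F) v) : LinearIndependent F v := by
  classical
  rw [linearIndependent_iff'] at h ⊢
  intro s
  induction s using Finset.induction_on with
  | empty => simp
  | insert a s ha ih =>
    intro f hf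
    have hfa : f a = 0 := by
      by_contra hne
      -- Normalize the coefficient of v a to 1 and differentiate. This gives a relation without v a,
      -- whose coefficients vanish by induction; so the normalized coefficients are constants,
      -- contradicting independence over the constants.
      have h1 : v a + ∑ i ∈ s, ((f a)⁻¹ * f i) • v i = 0 := by
        rw [Finset.sum_insert ha] at hf
        have := congrArg ((f a)⁻¹ • ·) hf
        simpa [Finset.smul_sum, smul_smul, inv_mul_cancel₀ hne] using this
      have h2 : ∑ i ∈ s, ((f a)⁻¹ * f i)′ • v i = 0 := by
        have h3 := congrArg (fun z : H => z′) h1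
        have h6 : ∀ (c : F) (i : ι), (c • v i)′ = c′ • v i := fun c i => by
          rw [Algebra.smul_def, Derivation.leibniz, hv, smul_zero, zero_add, deriv_algebraMap,
            smul_eq_mul, mul_comm, Algebra.smul_def]
        simpa only [map_add, hv, zero_add, map_sum, h6, map_zero] using h3
      have h4 := ih _ h2
      let g : ι → constants F := fun i => if hi : i ∈ s then ⟨(f a)⁻¹ * f i, h4 i hi⟩ else 1
      have h5 := h (insert a s) g (by
        rw [Finset.sum_insert ha, ← h1]
        congr 1
        · simp [g, ha]
        · refine Finset.sum_congr rfl fun i hi => ?_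
          simp [g, hi, Subfield.smul_def]) a (Finset.mem_insert_self _ _)
      simp [g, ha] at h5
    rw [Finset.sum_insert ha, hfa, zero_smul, zero_add] at hf
    intro i hi
    rcases Finset.mem_insert.mp hi with rfl | hi
    · exact hfa
    · exact ih f hf i hi

end Constants

/-- A homomorphism of algebras factors through an injective one if its values on generators are in
the range. -/
theorem AlgHom.exists_factor {R B X Y : Type*} [CommRing R] [Ring B] [Ring X] [Ring Y]
    [Algebra R B] [Algebra R X] [Algebra R Y] {s : Set B} (hs : Algebra.adjoin R s = ⊤)
    (f : B →ₐ[R] X) (j : Y →ₐ[R] X) (hj : Function.Injective j) (h : ∀ b ∈ s, ∃ y, j y = f b) :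
    ∃ g : B →ₐ[R] Y, ∀ b, j (g b) = f b := by
  have hle : ∀ b, f b ∈ j.range := by
    intro b
    have : Algebra.adjoin R s ≤ j.range.comap f := Algebra.adjoin_le h
    exact this (hs ▸ Algebra.mem_top)
  refine ⟨(AlgEquiv.ofInjective j hj).symm.toAlgHom.comp (f.codRestrict j.range hle), fun b => ?_⟩
  exact congrArg Subtype.val
    ((AlgEquiv.ofInjective j hj).apply_symm_apply ⟨f b, hle b⟩)

/-! ### Descent of a Hopf algebra generated by a matrix -/

section Descent

/-! ### Extension of scalars from a subfield, under linear disjointness. -/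

section Maps

variable {C F H : Type u} [Field C] [Field F] [Algebra C F] [CommRing H] [Algebra F H] [Algebra C H]
  [IsScalarTower C F H]

variable (F) in
/-- The multiplication map `F ⊗ B → H`. -/
noncomputable def extendMap (B : Subalgebra C H) : F ⊗[C] B →ₐ[F] H :=
  Algebra.TensorProduct.lift (Algebra.ofId F H) B.val (fun _ _ => Commute.all _ _)

theorem extendMap_tmul (B : Subalgebra C H) (c : F) (b : B) :
    extendMap F B (c ⊗ₜ b) = c • (b : H) := by
  simp [extendMap, Algebra.ofId_apply, Algebra.smul_def]

/-- The hypothesis is linear disjointness of B and F over C: a C-basis of B stays independent over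
F. -/
theorem extendMap_injective (B : Subalgebra C H)
    (hB : ∀ (ι : Type u) (v : ι → B), LinearIndependent C v →
      LinearIndependent F fun i => (v i : H)) :
    Function.Injective (extendMap F B) := by
  let b := Module.Basis.ofVectorSpace C B
  have hb := hB _ b b.linearIndependent
  have h1 : (extendMap F B).toLinearMap =
      (Algebra.TensorProduct.basis F b).constr F (fun i => (b i : H)) := by
    refine (Algebra.TensorProduct.basis F b).ext fun i => ?_
    rw [Module.Basis.constr_basis, Algebra.TensorProduct.basis_apply, AlgHom.toLinearMap_apply,
      extendMap_tmul, one_smul]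
  have h2 := Module.Basis.injective_constr_of_linearIndependent (R₂ := F)
    (Algebra.TensorProduct.basis F b) hb
  rw [← h1] at h2
  exact h2

theorem extendMap_surjective {s : Set H} (hgen : Algebra.adjoin F s = ⊤) :
    Function.Surjective (extendMap F (Algebra.adjoin C s)) := by
  rw [← AlgHom.range_eq_top, eq_top_iff, ← hgen]
  refine Algebra.adjoin_le fun x hx => ?_
  exact ⟨1 ⊗ₜ ⟨x, Algebra.subset_adjoin hx⟩, by simp [extendMap_tmul]⟩

variable (F) in
/-- The map `B ⊗ B → H ⊗ H`. -/
noncomputable def squareMap (B : Subalgebra C H) : B ⊗[C] B →ₐ[C] H ⊗[F] H :=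
  Algebra.TensorProduct.lift
    ((Algebra.TensorProduct.includeLeft : H →ₐ[C] H ⊗[F] H).comp B.val)
    (((Algebra.TensorProduct.includeRight : H →ₐ[F] H ⊗[F] H).restrictScalars C).comp B.val)
    (fun _ _ => Commute.all _ _)

theorem squareMap_tmul (B : Subalgebra C H) (a b : B) :
    squareMap F B (a ⊗ₜ b) = (a : H) ⊗ₜ (b : H) := by
  simp [squareMap]

/-- The comultiplication of F ⊗ B is built with this interchange of factors; this translates it into
H ⊗ H. -/
theorem map_extendMap_tensorTensorTensorComm (B : Subalgebra C H) (z : B ⊗[C] B) :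
    Algebra.TensorProduct.map (extendMap F B) (extendMap F B)
      (TensorProduct.AlgebraTensorModule.tensorTensorTensorComm C F C F F F B B
        ((1 ⊗ₜ 1) ⊗ₜ z)) = squareMap F B z := by
  induction z with
  | zero => rw [TensorProduct.tmul_zero, LinearEquiv.map_zero, map_zero, map_zero]
  | add p q hp hq => rw [TensorProduct.tmul_add, LinearEquiv.map_add, map_add, map_add, hp, hq]
  | tmul p q => simp [squareMap_tmul, extendMap_tmul]

/-- For a C-basis b of B, the tensors b i ⊗ b j are independent over F in H ⊗_F H, hence over C. -/
theorem squareMap_injective (B : Subalgebra C H)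
    (hB : ∀ (ι : Type u) (v : ι → B), LinearIndependent C v →
      LinearIndependent F fun i => (v i : H)) :
    Function.Injective (squareMap F B) := by
  let b := Module.Basis.ofVectorSpace C B
  have hb := hB _ b b.linearIndependent
  have hbb : LinearIndependent C (fun p : _ × _ => (b p.1 : H) ⊗ₜ[F] (b p.2 : H)) :=
    (hb.tmul_of_isDomain hb).restrict_scalars' C
  have h1 : (squareMap F B).toLinearMap = (b.tensorProduct b).constr C
      (fun p : _ × _ => (b p.1 : H) ⊗ₜ[F] (b p.2 : H)) := by
    refine (b.tensorProduct b).ext fun p => ?_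
    rw [Module.Basis.constr_basis, Module.Basis.tensorProduct_apply', AlgHom.toLinearMap_apply,
      squareMap_tmul]
  have h2 := Module.Basis.injective_constr_of_linearIndependent (R₂ := C)
    (b.tensorProduct b) hbb
  rw [← h1] at h2
  exact h2

end Maps

open IsMultiplicativeMatrix in
/-- A Hopf algebra over `F` generated by the coordinates of a multiplicative matrix `h` comes from
the algebra generated by these coordinates over a subfield `C`, when this algebra is linearly
disjoint from `F`. -/
theorem exists_hopfAlgebra_form {C F H : Type u} [Field C] [Field F] [Algebra C F] [CommRing H]
    [HopfAlgebra F H] [Algebra C H] [IsScalarTower C F H] {n : ℕ} {h : Matrix (Fin n) (Fin n) H}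
    (hh : IsMultiplicativeMatrix F h) (hgen : Algebra.adjoin F (coordinates F h) = ⊤)
    (hB : ∀ (ι : Type u) (v : ι → Algebra.adjoin C (coordinates F h)),
      LinearIndependent C v → LinearIndependent F fun i => (v i : H)) :
    ∃ (B : Type u) (_ : CommRing B) (_ : HopfAlgebra C B) (x : Matrix (Fin n) (Fin n) B)
      (ψ : F ⊗[C] B ≃ₐc[F] H), IsAlgebraicSubgroupGL C B x ∧
        ∀ b : B, ∃ y ∈ Algebra.adjoin C (coordinates F h),
          ∀ c : F, ψ (c ⊗ₜ b) = c • y := by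
  set B := Algebra.adjoin C (coordinates F h)
  have hsub : coordinates F h ⊆ B := Algebra.subset_adjoin
  let x : Matrix (Fin n) (Fin n) B := fun i j => ⟨h i j, hsub (apply_mem_coordinates h i j)⟩
  let d : B := ⟨HopfAlgebra.antipode F h.det, hsub (antipode_det_mem_coordinates h)⟩
  have hxgen : Algebra.adjoin C (insert d (Set.range fun p : Fin n × Fin n => x p.1 p.2)) = ⊤ := by
    have himg : B.val '' (insert d (Set.range fun p : Fin n × Fin n => x p.1 p.2)) =
        coordinates F h := by
      rw [Set.image_insert_eq, ← Set.range_comp]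
      rfl
    refine Subalgebra.map_injective (f := B.val) Subtype.val_injective ?_
    rw [AlgHom.map_adjoin, himg, Algebra.map_top, Subalgebra.range_val]
  -- By this injectivity Δ descends to B once it sends the coordinates into the image of B ⊗ B. The
  -- counit and antipode descend likewise, through C → F and B → H.
  have hj := squareMap_injective (F := F) B hB
  obtain ⟨Δ, hΔ⟩ := AlgHom.exists_factor hxgen
    (((Bialgebra.comulAlgHom F H).restrictScalars C).comp B.val) (squareMap F B) hj (by
      rintro y (hy | ⟨⟨i, j⟩, rfl⟩)
      · exact ⟨d ⊗ₜ d, by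
          rw [hy, squareMap_tmul]
          exact hh.comul_antipode_det.symm⟩
      · exact ⟨∑ k, x i k ⊗ₜ x k j, by
          rw [map_sum]
          simp only [squareMap_tmul]
          exact (hh.comul i j).symm⟩)
  obtain ⟨ε, hε⟩ := AlgHom.exists_factor hxgen
    (((Bialgebra.counitAlgHom F H).restrictScalars C).comp B.val) (Algebra.ofId C F)
    (algebraMap C F).injective (by
      rintro y (hy | ⟨⟨i, j⟩, rfl⟩)
      · exact ⟨1, by rw [hy, map_one]; exact hh.counit_antipode_det.symm⟩
      · refine ⟨(1 : Matrix (Fin n) (Fin n) C) i j, Eq.trans ?_ (hh.counit i j).symm⟩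
        rw [Matrix.one_apply, Matrix.one_apply]
        split_ifs <;> simp)
  obtain ⟨S, hS⟩ := AlgHom.exists_factor hxgen
    (((HopfAlgebra.antipodeAlgHom F H).restrictScalars C).comp B.val) B.val
    Subtype.val_injective (by
      intro y hy
      have hy' : (y : H) ∈ coordinates F h := by
        rcases hy with hy | ⟨⟨i, j⟩, rfl⟩
        · rw [hy]; exact antipode_det_mem_coordinates h
        · exact apply_mem_coordinates h i j
      exact ⟨⟨_, hh.antipode_mem hsub hy'⟩, rfl⟩)
  have hΔx : ∀ i j, Δ (x i j) = ∑ k, x i k ⊗ₜ x k j := fun i j => hj (by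
    rw [hΔ, map_sum]
    simp only [squareMap_tmul]
    exact hh.comul i j)
  have hΔd : Δ d = d ⊗ₜ d := hj (by
    rw [hΔ, squareMap_tmul]
    exact hh.comul_antipode_det)
  have hεx : ∀ i j, ε (x i j) = (1 : Matrix (Fin n) (Fin n) C) i j := fun i j =>
    (algebraMap C F).injective (by
      refine (hε _).trans ((hh.counit i j).trans ?_)
      rw [Matrix.one_apply, Matrix.one_apply]
      split_ifs <;> simp)
  have hεd : ε d = 1 := (algebraMap C F).injective (by
      refine (hε _).trans (hh.counit_antipode_det.trans ?_)
      rw [map_one])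
  have hSx : x.map S * x = 1 := by
    ext i j
    have h1 := congrFun (congrFun hh.map_antipode_mul i) j
    rw [Matrix.mul_apply] at h1 ⊢
    have h2 : ∀ k, ((S (x i k) : B) : H) = HopfAlgebra.antipode F (h i k) := fun k => hS _
    simp only [Matrix.map_apply, AddSubmonoidClass.coe_finsetSum, MulMemClass.coe_mul, h2] at h1 ⊢
    rw [Matrix.one_apply] at h1 ⊢
    refine h1.trans ?_
    split_ifs <;> rfl
  have hSd : S d * d = 1 := Subtype.ext (by
    have h2 : ((S d : B) : H) = h.det := (hS d).trans hh.antipode_antipode_det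
    change ((S d : B) : H) * HopfAlgebra.antipode F h.det = 1
    rw [h2, mul_comm, hh.antipode_det_mul_det])
  let I : HopfAlgebra C B := hopfAlgebraOfMatrix hxgen Δ ε S hΔx hΔd hεx hεd hSx hSd
  let e : F ⊗[C] B ≃ₐ[F] H := AlgEquiv.ofBijective (extendMap F B)
    ⟨extendMap_injective B hB, extendMap_surjective hgen⟩
  have he : ∀ c b, e (c ⊗ₜ b) = c • (b : H) := extendMap_tmul B
  let ψ : F ⊗[C] B ≃ₐc[F] H := BialgEquiv.ofAlgEquiv e
    (by
      refine Algebra.TensorProduct.ext (by ext) ?_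
      refine AlgHom.ext fun b => ?_
      change Coalgebra.counit (R := F) (e (1 ⊗ₜ b)) = ε b • (1 : F)
      rw [he, one_smul, Algebra.smul_def, mul_one]
      exact (hε b).symm)
    (by
      refine Algebra.TensorProduct.ext (by ext) ?_
      refine AlgHom.ext fun b => ?_
      change Algebra.TensorProduct.map e.toAlgHom e.toAlgHom
        (TensorProduct.AlgebraTensorModule.tensorTensorTensorComm C F C F F F B B
          ((1 ⊗ₜ 1) ⊗ₜ Δ b)) = Coalgebra.comul (R := F) (e (1 ⊗ₜ b))
      rw [he, one_smul]
      exact (map_extendMap_tensorTensorTensorComm B (Δ b)).trans (hΔ b))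
  -- The last component keeps track of where ψ sends B: when the coordinates are constant, this
  -- makes ψ compatible with the derivations.
  refine ⟨B, inferInstance, I, x, ψ, ⟨hΔx, hεx, d, ?_, hxgen⟩, 
    fun b => ⟨b, b.2, fun c => he c b⟩⟩
  refine Subtype.ext ?_
  have h1 : ((x.det : B) : H) = h.det := B.val.map_det x
  change HopfAlgebra.antipode F h.det * ((x.det : B) : H) = 1
  rw [h1, hh.antipode_det_mul_det]

end Descent

/-! ### The base change of a differential algebra -/

section BaseChange

variable {K F A : Type u} [Field K] [Differential K] [Field F] [Differential F]
  [Algebra K F] [DifferentialAlgebra K F] [CommRing A] [Algebra K A] [Differential A]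
  [DifferentialAlgebra K A]

theorem tensorDeriv_mul (p q : F ⊗[K] A) :
    tensorDeriv K F A (p * q) = p * tensorDeriv K F A q + q * tensorDeriv K F A p := by
  induction p with
  | zero => simp
  | add p₁ p₂ h₁ h₂ => simp only [add_mul, mul_add, map_add, h₁, h₂]; abel
  | tmul a b =>
    induction q with
    | zero => simp
    | add q₁ q₂ h₁ h₂ => simp only [add_mul, mul_add, map_add, h₁, h₂]; abel
    | tmul c d =>
      simp only [Algebra.TensorProduct.tmul_mul_tmul, tensorDeriv_tmul, Derivation.leibniz,
        smul_eq_mul, TensorProduct.add_tmul, TensorProduct.tmul_add, mul_add]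
      simp only [mul_comm c, mul_comm d]
      abel

variable (K F A) in
/-- The derivation of `F ⊗ A`. -/
noncomputable abbrev baseChangeDifferential : Differential (F ⊗[K] A) :=
  differentialOfLeibniz (tensorDeriv K F A) tensorDeriv_mul

theorem baseChange_differentialAlgebra :
    letI := baseChangeDifferential K F A
    DifferentialAlgebra F (F ⊗[K] A) :=
  letI := baseChangeDifferential K F A
  ⟨fun c => by
    change tensorDeriv K F A (c ⊗ₜ 1) = c′ ⊗ₜ 1
    simp [tensorDeriv_tmul]⟩

end BaseChange

/-! ### Matrices -/

section Matrices

theorem map_deriv_mul {R : Type*} [CommRing R] [Differential R] {n : ℕ}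
    (M N : Matrix (Fin n) (Fin n) R) : (M * N).map (fun x : R => x′) =
      M.map (fun x : R => x′) * N + M * N.map (fun x : R => x′) := by
  ext i j
  simp only [Matrix.map_apply, Matrix.mul_apply, Matrix.add_apply, map_sum, Derivation.leibniz,
    smul_eq_mul, ← Finset.sum_add_distrib]
  exact Finset.sum_congr rfl fun k _ => by ring

namespace IsMultiplicativeMatrix

variable {K A n : Type*} [Field K] [CommRing A] [HopfAlgebra K A] [Fintype n] [DecidableEq n]

theorem map_comul {g : Matrix n n A} (hg : IsMultiplicativeMatrix K g) :
    g.map (Bialgebra.comulAlgHom K A) =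
      g.map (Algebra.TensorProduct.includeLeft : A →ₐ[K] A ⊗[K] A) *
        g.map (Algebra.TensorProduct.includeRight : A →ₐ[K] A ⊗[K] A) := by
  ext i j
  simp [Matrix.mul_apply, hg.comul]

theorem map_counit {g : Matrix n n A} (hg : IsMultiplicativeMatrix K g) :
    g.map (Bialgebra.counitAlgHom K A) = 1 := by
  ext i j
  simp [hg.counit]

theorem map_conj {n K A B : Type*} [Fintype n] [CommRing K] [CommRing A] [CommRing B] [Algebra K A]
    [Algebra K B] (g : Matrix n n A) (P Q : Matrix n n K) (f : A →ₐ[K] B) :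
    (Q.map (algebraMap K A) * g * P.map (algebraMap K A)).map f =
      Q.map (algebraMap K B) * g.map f * P.map (algebraMap K B) := by
  have hsc : ∀ M : Matrix n n K, (M.map (algebraMap K A)).map f = M.map (algebraMap K B) := by
    intro M
    ext i j
    simp
  rw [Matrix.map_mul, Matrix.map_mul, hsc, hsc]

/-- A conjugate of a multiplicative matrix by a matrix of scalars is multiplicative. -/
theorem conj {g : Matrix n n A} (hg : IsMultiplicativeMatrix K g) {P Q : Matrix n n K}
    (h : P * Q = 1) :
    IsMultiplicativeMatrix K (Q.map (algebraMap K A) * g * P.map (algebraMap K A)) := by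
  refine ⟨fun i j => ?_, fun i j => ?_⟩
  · have h1 : P.map (algebraMap K (A ⊗[K] A)) * Q.map (algebraMap K (A ⊗[K] A)) = 1 := by
      rw [← Matrix.map_mul, h, Matrix.map_one _ (map_zero _) (map_one _)]
    have h2 := congrFun (congrFun (map_conj g P Q (Bialgebra.comulAlgHom K A)) i) j
    rw [hg.map_comul] at h2
    refine h2.trans ?_
    have h3 : Q.map (algebraMap K (A ⊗[K] A)) *
        (g.map (Algebra.TensorProduct.includeLeft : A →ₐ[K] A ⊗[K] A) *
          g.map (Algebra.TensorProduct.includeRight : A →ₐ[K] A ⊗[K] A)) *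
        P.map (algebraMap K (A ⊗[K] A)) =
        (Q.map (algebraMap K A) * g * P.map (algebraMap K A)).map
          (Algebra.TensorProduct.includeLeft : A →ₐ[K] A ⊗[K] A) *
        (Q.map (algebraMap K A) * g * P.map (algebraMap K A)).map
          (Algebra.TensorProduct.includeRight : A →ₐ[K] A ⊗[K] A) := by
      rw [map_conj, map_conj]
      simp only [mul_assoc]
      rw [← mul_assoc (P.map _) (Q.map _), h1, one_mul]
    rw [h3, Matrix.mul_apply]
    simp
  · have h2 := congrFun (congrFun (map_conj g P Q (Bialgebra.counitAlgHom K A)) i) j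
    refine h2.trans ?_
    rw [hg.map_counit, mul_one, ← Matrix.map_mul, mul_eq_one_comm.mp h]
    rfl

/-- The base change of a multiplicative matrix is multiplicative. -/
theorem baseChange {K A F : Type u} {n : Type*} [Field K] [CommRing A] [HopfAlgebra K A] [Fintype n]
    [DecidableEq n] [Field F] [Algebra K F] {g : Matrix n n A} (hg : IsMultiplicativeMatrix K g) :
    IsMultiplicativeMatrix F (g.map fun a => (1 : F) ⊗ₜ[K] a) where
  comul i j := by
    simp only [Matrix.map_apply, TensorProduct.comul_tmul, hg.comul, TensorProduct.tmul_sum, map_sum]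
    rfl
  counit i j := by
    simp only [Matrix.map_apply, TensorProduct.counit_tmul, hg.counit, Matrix.one_apply]
    split_ifs <;> simp

end IsMultiplicativeMatrix

end Matrices

/-! ### From splittings to constant groups -/

/-- The constants of a differential algebra over `F`, as an algebra over the constants of `F`. -/
def constantSubalgebra (F H : Type*) [Field F] [Differential F] [CommRing H] [Algebra F H]
    [Differential H] [DifferentialAlgebra F H] : Subalgebra (constants F) H where
  carrier := {x | x′ = 0}
  mul_mem' := by
    intro a b (ha : a′ = 0) (hb : b′ = 0)
    change (a * b)′ = 0
    simp [ha, hb]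
  add_mem' := by
    intro a b (ha : a′ = 0) (hb : b′ = 0)
    change (a + b)′ = 0
    simp [ha, hb]
  algebraMap_mem' := by
    rintro ⟨c, hc : c′ = 0⟩
    change (algebraMap F H c)′ = 0
    rw [deriv_algebraMap, hc, map_zero]

open IsMultiplicativeMatrix in
theorem coordinates_subset_constantSubalgebra {F H n : Type*} [Field F] [Differential F]
    [CommRing H] [HopfAlgebra F H] [Differential H] [DifferentialAlgebra F H] [Fintype n]
    [DecidableEq n] {h : Matrix n n H} (hh : IsMultiplicativeMatrix F h)
    (hc : ∀ i j, (h i j)′ = 0) : coordinates F h ⊆ constantSubalgebra F H := by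
  have hdet : h.det′ = 0 := det_mem (q := constantSubalgebra F H) hc
  rintro _ (rfl | ⟨⟨i, j⟩, rfl⟩)
  · change (HopfAlgebra.antipode F h.det)′ = 0
    have h1 := congrArg (fun z : H => z′) hh.antipode_det_mul_det
    simp only [Derivation.leibniz, hdet, Derivation.map_one_eq_zero, smul_eq_mul, mul_zero,
      zero_add] at h1
    calc _ = HopfAlgebra.antipode F h.det *
          (h.det * (HopfAlgebra.antipode F h.det)′) := by
          rw [← mul_assoc, hh.antipode_det_mul_det, one_mul]
      _ = 0 := by rw [h1, mul_zero]
  · exact hc i j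

namespace DiffRep

/-- A splitting of the prolongation gives a linear differential equation for the matrix
coefficients. -/
theorem ProlongSplits.exists_matrix {K A V W : Type u} [Field K] [Differential K] [CommRing A]
    [HopfAlgebra K A] [Differential A] [DifferentialAlgebra K A] [DiffHopfAlgebra K A]
    [AddCommGroup V] [Module K V] [AddCommGroup W] [Module K W] {F : Type u} [Field F]
    [Algebra K F] {r : DiffRep K A V} {r₁ : DiffRep K A W} (h : r.ProlongSplits F r₁)
    {n : Type*} [Fintype n] [DecidableEq n] (b : Module.Basis n K V) :
    ∃ β : Matrix n n F, ∀ k j, ∑ i, β i j ⊗ₜ[K] r.coeff b k i =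
      ∑ i, β k i ⊗ₜ[K] r.coeff b i j + (1 : F) ⊗ₜ[K] (r.coeff b k j)′ := by
  obtain ⟨e, he, he₁⟩ := h
  let κ : n → F ⊗[K] V →ₗ[K] F := fun k =>
    (TensorProduct.rid K F).toLinearMap ∘ₗ (b.coord k).lTensor F
  let π : F ⊗[K] (V × W) →ₗ[K] F ⊗[K] V := (LinearMap.fst K V W).lTensor F
  have hκ : ∀ k c i, κ k (c ⊗ₜ b i) = if i = k then c else 0 := by
    intro k c i
    simp only [κ, LinearMap.comp_apply, LinearMap.lTensor_tmul, Module.Basis.coord_apply,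
      Module.Basis.repr_self, Finsupp.single_apply, LinearEquiv.coe_coe, TensorProduct.rid_tmul]
    split_ifs <;> simp
  have hsum : ∀ y : F ⊗[K] V, y = ∑ i, κ i y ⊗ₜ b i := by
    intro y
    induction y with
    | zero => simp
    | add y z hy hz =>
      simp only [map_add, TensorProduct.add_tmul, Finset.sum_add_distrib, ← hy, ← hz]
    | tmul c v =>
      conv_lhs => rw [← b.sum_repr v, TensorProduct.tmul_sum]
      simp [κ, TensorProduct.smul_tmul]
  -- Column j of β holds the V-component of the image of ∂ ⊗ b j under the splitting.
  let β : Matrix n n F := fun i j => κ i (π (e (1 ⊗ₜ Prolong.del K (b j))))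
  -- The projection of the direct sum onto V commutes with the coactions.
  have hπ : ∀ k y, (κ k ∘ₗ π).rTensor A ((r.directSum r₁).coactBaseChange F y) =
      (κ k).rTensor A (r.coactBaseChange F (π y)) := by
    intro k y
    have h1 : ∀ (c : F) (w : W), (r.directSum r₁).coactBaseChange F (c ⊗ₜ (0, w)) =
        ((LinearMap.inr K V W).lTensor F).rTensor A (r₁.coactBaseChange F (c ⊗ₜ w)) := by
      intro c w
      simp only [coactBaseChange, directSum, LinearMap.comp_apply, LinearMap.lTensor_tmul,
        LinearMap.coprod_apply, map_zero, zero_add, LinearEquiv.coe_coe]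
      generalize r₁.coact w = z
      induction z with
      | zero => simp
      | add p q hp hq => simp only [map_add, TensorProduct.tmul_add, hp, hq]
      | tmul p q => simp
    have h2 : ∀ (c : F) (v : V), (r.directSum r₁).coactBaseChange F (c ⊗ₜ (v, 0)) =
        ((LinearMap.inl K V W).lTensor F).rTensor A (r.coactBaseChange F (c ⊗ₜ v)) := by
      intro c w
      simp only [coactBaseChange, directSum, LinearMap.comp_apply, LinearMap.lTensor_tmul,
        LinearMap.coprod_apply, map_zero, add_zero, LinearEquiv.coe_coe]
      generalize r.coact w = z
      induction z with
      | zero => simp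
      | add p q hp hq => simp only [map_add, TensorProduct.tmul_add, hp, hq]
      | tmul p q => simp
    have h3 : π ∘ₗ (LinearMap.inl K V W).lTensor F = LinearMap.id := by
      rw [← LinearMap.lTensor_comp, LinearMap.fst_comp_inl, LinearMap.lTensor_id]
    have h4 : π ∘ₗ (LinearMap.inr K V W).lTensor F = 0 := by
      rw [← LinearMap.lTensor_comp, LinearMap.fst_comp_inr, LinearMap.lTensor_zero]
    have h3' : (κ k ∘ₗ π) ∘ₗ (LinearMap.inl K V W).lTensor F = κ k :=
      congrArg (κ k ∘ₗ ·) h3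
    have h4' : (κ k ∘ₗ π) ∘ₗ (LinearMap.inr K V W).lTensor F = 0 :=
      (congrArg (κ k ∘ₗ ·) h4).trans (LinearMap.comp_zero _)
    induction y with
    | zero => simp
    | add y z hy hz => simp only [map_add, hy, hz]
    | tmul c p =>
      obtain ⟨v, w⟩ := p
      have h5 : c ⊗ₜ[K] ((v, w) : V × W) = c ⊗ₜ (v, 0) + c ⊗ₜ (0, w) := by
        rw [← TensorProduct.tmul_add]
        simp
      have h6 : π (c ⊗ₜ[K] ((v, w) : V × W)) = c ⊗ₜ v := rfl
      rw [h6, h5, map_add, map_add, h1, h2, ← LinearMap.rTensor_comp_apply,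
        ← LinearMap.rTensor_comp_apply, h3', h4']
      simp
  have hr : ∀ k (c : F) i, (κ k).rTensor A (r.coactBaseChange F (c ⊗ₜ b i)) =
      c ⊗ₜ r.coeff b k i := by
    intro k c i
    simp only [coactBaseChange, LinearMap.comp_apply, LinearMap.lTensor_tmul, r.coact_basis b,
      TensorProduct.tmul_sum, map_sum, LinearEquiv.coe_coe, TensorProduct.assoc_symm_tmul,
      LinearMap.rTensor_tmul, hκ, TensorProduct.ite_tmul, Finset.sum_ite_eq', Finset.mem_univ,
      if_true]
  refine ⟨β, fun k j => ?_⟩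
  -- The k-th coordinate of the V-component of equivariance at ∂ ⊗ b j. Terms ∂ ⊗ b i contribute βg;
  -- terms 1 ⊗ b i contribute g′, because e is the identity on V.
  have h1 := congrArg ((κ k ∘ₗ π).rTensor A) (he (1 ⊗ₜ Prolong.del K (b j)))
  rw [hπ, hsum (π (e (1 ⊗ₜ Prolong.del K (b j)))), map_sum, map_sum] at h1
  simp only [hr] at h1
  refine h1.trans ?_
  have h2 : r.prolong.coact (Prolong.del K (b j)) = ∑ i,
      (Prolong.del K (b i) ⊗ₜ r.coeff b i j + Prolong.incl K (b i) ⊗ₜ (r.coeff b i j)′) := by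
    refine (r.prolongCoact_del (b j)).trans ?_
    rw [r.coact_basis b, map_sum]
    rfl
  simp only [coactBaseChange, LinearMap.comp_apply, LinearMap.lTensor_tmul, h2,
    TensorProduct.tmul_sum, TensorProduct.tmul_add, map_sum, map_add, LinearEquiv.coe_coe,
    TensorProduct.assoc_symm_tmul, LinearMap.rTensor_tmul, LinearMap.restrictScalars_apply, he₁,
    Finset.sum_add_distrib]
  congr 1
  have h3 : ∀ (c : F) (v : V), π (c ⊗ₜ[K] ((v, 0) : V × W)) = c ⊗ₜ v := fun _ _ => rfl
  simp only [h3, hκ, TensorProduct.ite_tmul, Finset.sum_ite_eq', Finset.mem_univ, if_true]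

end DiffRep

/-- Conjugation by a fundamental matrix makes the matrix coefficients constant. -/
theorem deriv_conj_eq_zero {F H : Type*} [Field F] [Differential F] [CommRing H] [Differential H]
    [Algebra F H] [DifferentialAlgebra F H] {n : ℕ} {P Q β : Matrix (Fin n) (Fin n) F}
    {G : Matrix (Fin n) (Fin n) H} (hPQ : Q * P = 1)
    (hP : P.map (fun x : F => x′) = -(β * P))
    (hG : G * β.map (algebraMap F H) =
      β.map (algebraMap F H) * G + G.map (fun x : H => x′)) :
    (Q.map (algebraMap F H) * G * P.map (algebraMap F H)).map (fun x : H => x′) = 0 := by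
  -- Differentiate QP = 1. Then the derivative of QGP is Q(βG + G′ - Gβ)P, which is zero.
  have hQ : Q.map (fun x : F => x′) = Q * β := by
    have h1 := map_deriv_mul Q P
    rw [hPQ, hP] at h1
    have h2 : (1 : Matrix (Fin n) (Fin n) F).map (fun x : F => x′) = 0 := by
      ext i j
      rw [Matrix.map_apply, Matrix.one_apply]
      split_ifs <;> simp
    rw [h2, Matrix.mul_neg, ← sub_eq_add_neg, eq_comm, sub_eq_zero] at h1
    calc _ = Q.map (fun x : F => x′) * P * Q := by
          rw [mul_assoc, mul_eq_one_comm.mp hPQ, mul_one]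
      _ = _ := by rw [h1, mul_assoc, mul_assoc, mul_eq_one_comm.mp hPQ, mul_one]
  have hsc : ∀ M : Matrix (Fin n) (Fin n) F, (M.map (algebraMap F H)).map (fun x : H => x′) =
      (M.map (fun x : F => x′)).map (algebraMap F H) := by
    intro M
    ext i j
    simp [deriv_algebraMap]
  have hneg : (-(β * P)).map (algebraMap F H) =
      -(β.map (algebraMap F H) * P.map (algebraMap F H)) := by
    rw [← Matrix.map_mul]
    ext i j
    exact map_neg (algebraMap F H) _
  rw [map_deriv_mul, map_deriv_mul, hsc, hsc, hP, hQ, hneg, Matrix.map_mul,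
    ← sub_eq_iff_eq_add'.mpr hG]
  noncomm_ring

open IsMultiplicativeMatrix in
/-- If the prolongation of a faithful representation splits over a differentially closed field, then
the group is isomorphic to a group of constant matrices. -/
theorem isIsoToConstantGroup_of_prolongSplits {K F A V W : Type u} [Field K] [Differential K]
    [Field F] [Differential F] [Algebra K F] [DifferentialAlgebra K F]
    (hF : IsDifferentiallyClosed F) [CommRing A] [HopfAlgebra K A] [Differential A]
    [DifferentialAlgebra K A] [DiffHopfAlgebra K A] [IsReduced A] [AddCommGroup V] [Module K V]
    [FiniteDimensional K V] [AddCommGroup W] [Module K W] {r : DiffRep K A V} {r₁ : DiffRep K A W}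
    (hr : r.IsFaithful) (h : r.ProlongSplits F r₁) : IsIsoToConstantGroup K F A := by
  let b := Module.finBasis K V
  have hg := r.isMultiplicativeMatrix_coeff b
  have hgen := hr.diffAdjoin_coordinates b
  obtain ⟨β, hβ⟩ := h.exists_matrix b
  set g := r.coeff b
  obtain ⟨P, hPdet, hP⟩ := hF.exists_fundamental β
  let _ := baseChangeDifferential K F A
  have := baseChange_differentialAlgebra (K := K) (F := F) (A := A)
  have hderiv : ∀ (c : F) (a : A), (c ⊗ₜ[K] a : F ⊗[K] A)′ = c′ ⊗ₜ a + c ⊗ₜ a′ := fun _ _ => rfl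
  let G : Matrix (Fin _) (Fin _) (F ⊗[K] A) := g.map fun a => (1 : F) ⊗ₜ[K] a
  have hG : IsMultiplicativeMatrix F G := hg.baseChange
  have hPQ : P * P⁻¹ = 1 := Matrix.mul_nonsing_inv P (Ne.isUnit hPdet)
  let h : Matrix (Fin _) (Fin _) (F ⊗[K] A) := P⁻¹.map (algebraMap F (F ⊗[K] A)) * G * P.map (algebraMap F (F ⊗[K] A))
  have hh : IsMultiplicativeMatrix F h := hG.conj hPQ
  have hPQ' : P.map (algebraMap F (F ⊗[K] A)) * P⁻¹.map (algebraMap F (F ⊗[K] A)) = 1 := by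
    rw [← Matrix.map_mul, hPQ, Matrix.map_one _ (map_zero _) (map_one _)]
  have hc : ∀ i j, (h i j)′ = 0 := by
    have hd := deriv_conj_eq_zero (H := F ⊗[K] A) (G := G) (mul_eq_one_comm.mp hPQ)
      (P := P) (β := β) (by
        ext i j
        rw [Matrix.map_apply, hP, Matrix.neg_apply, Matrix.mul_apply]) (by
        ext k j
        have h1 := hβ k j
        simp only [Matrix.mul_apply, Matrix.add_apply, Matrix.map_apply, G, hderiv,
          Algebra.TensorProduct.algebraMap_apply, Algebra.TensorProduct.tmul_mul_tmul, one_mul,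
          mul_one, Algebra.algebraMap_self_apply, Derivation.map_one_eq_zero,
          TensorProduct.zero_tmul, zero_add]
        exact h1)
    exact fun i j => congrFun (congrFun hd i) j
  have hmem : ∀ x ∈ coordinates F h, x′ = 0 :=
    fun x hx => coordinates_subset_constantSubalgebra hh hc hx
  -- The algebra generated by the coordinates of h is already ∂-stable, because they are constant.
  -- It contains the entries of G = PhP⁻¹ and the inverse determinant, which conjugation does not
  -- change; so it contains 1 ⊗ A.
  let T : Subalgebra F (F ⊗[K] A) := Algebra.adjoin F (coordinates F h)
  have hT : ∀ x ∈ T, x′ ∈ T := fun x hx =>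
    deriv_mem_adjoin (fun a ha => by rw [hmem a ha]; exact zero_mem _) hx
  have hsub : coordinates F h ⊆ T := Algebra.subset_adjoin
  have hGT : ∀ i j, G i j ∈ T := by
    have h1 : G = P.map (algebraMap F (F ⊗[K] A)) * h * P⁻¹.map (algebraMap F (F ⊗[K] A)) := by
      simp only [h, mul_assoc]
      rw [hPQ', mul_one, ← mul_assoc, hPQ', one_mul]
    intro i j
    rw [h1, Matrix.mul_apply]
    refine sum_mem fun k _ => mul_mem ?_ (Subalgebra.algebraMap_mem _ _)
    rw [Matrix.mul_apply]
    exact sum_mem fun l _ => mul_mem (Subalgebra.algebraMap_mem _ _)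
      (hsub (apply_mem_coordinates h l k))
  have hdT : (1 : F) ⊗ₜ[K] HopfAlgebra.antipode K g.det ∈ T := by
    have h1 : (1 : F) ⊗ₜ[K] g.det = h.det := by
      have h2 : (1 : F) ⊗ₜ[K] g.det = G.det :=
        (Algebra.TensorProduct.includeRight : A →ₐ[K] F ⊗[K] A).map_det g
      have h3 : (P.map (algebraMap F (F ⊗[K] A))).det * (P⁻¹.map (algebraMap F (F ⊗[K] A))).det = 1 := by
        rw [← Matrix.det_mul, hPQ', Matrix.det_one]
      rw [h2, Matrix.det_mul, Matrix.det_mul, mul_right_comm,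
        mul_comm (P⁻¹.map (algebraMap F (F ⊗[K] A))).det, h3, one_mul]
    have h2 : (1 : F) ⊗ₜ[K] HopfAlgebra.antipode K g.det = HopfAlgebra.antipode F h.det := by
      refine left_inv_eq_right_inv (a := h.det) ?_ ?_
      · rw [← h1, Algebra.TensorProduct.tmul_mul_tmul, hg.antipode_det_mul_det, one_mul]
        rfl
      · rw [mul_comm, hh.antipode_det_mul_det]
    rw [h2]
    exact hsub (antipode_det_mem_coordinates h)
  have hA : ∀ a : A, (1 : F) ⊗ₜ[K] a ∈ T := by
    have hle : diffAdjoin K (coordinates K g) ≤ (T.restrictScalars K).comap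
        (Algebra.TensorProduct.includeRight : A →ₐ[K] F ⊗[K] A) := by
      refine diffAdjoin_le ?_ ?_
      · rintro _ (rfl | ⟨⟨i, j⟩, rfl⟩)
        · exact hdT
        · exact hGT i j
      · intro x hx
        have h1 : (1 : F) ⊗ₜ[K] x′ = ((1 : F) ⊗ₜ[K] x : F ⊗[K] A)′ := by simp [hderiv]
        change (1 : F) ⊗ₜ[K] x′ ∈ T
        rw [h1]
        exact hT _ hx
    rw [hgen] at hle
    exact fun a => hle (Algebra.mem_top (x := a))
  have hTtop : Algebra.adjoin F (coordinates F h) = ⊤ := by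
    refine eq_top_iff.mpr fun z _ => ?_
    induction z with
    | zero => exact zero_mem _
    | add p q hp hq => exact add_mem (hp trivial) (hq trivial)
    | tmul c a =>
      have h1 : c ⊗ₜ[K] a = c • ((1 : F) ⊗ₜ[K] a) := by
        rw [TensorProduct.smul_tmul', smul_eq_mul, mul_one]
      rw [h1]
      exact Subalgebra.smul_mem _ (hA a) c
  have hB₀ : ∀ y ∈ Algebra.adjoin (constants F) (coordinates F h), y′ = 0 :=
    fun y hy => Algebra.adjoin_le (coordinates_subset_constantSubalgebra hh hc) hy
  -- The disjointness required for descent is the independence of constants over F.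
  obtain ⟨B, _, _, x, ψ, hx, hψ⟩ := exists_hopfAlgebra_form (C := constants F) hh hTtop (by
    intro ι v hv
    refine linearIndependent_of_constants (fun i => hB₀ _ (v i).2) ?_
    exact hv.map' (Algebra.adjoin (constants F) (coordinates F h)).val.toLinearMap
      (LinearMap.ker_eq_bot.mpr Subtype.val_injective))
  refine ⟨_, B, inferInstance, inferInstance, x, hx, ψ.symm, fun z => ?_⟩
  have hψd : ∀ w, ψ (constTensorDeriv F B w) = (ψ w : F ⊗[K] A)′ := by
    intro w
    induction w with
    | zero => simp
    | add p q hp hq => rw [map_add, map_add, map_add, map_add, hp, hq]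
    | tmul c b =>
      obtain ⟨y, hy, hyc⟩ := hψ b
      have h1 : ψ (c′ ⊗ₜ b) = ((ψ (c ⊗ₜ b) : F ⊗[K] A)′) := by
        rw [hyc, hyc, Algebra.smul_def, Algebra.smul_def, Derivation.leibniz, hB₀ y hy,
          deriv_algebraMap, smul_zero, zero_add, smul_eq_mul, mul_comm]
      exact h1
  obtain ⟨w, rfl⟩ : ∃ w, ψ w = z := ⟨ψ.symm z, ψ.apply_symm_apply z⟩
  calc ψ.symm (tensorDeriv K F A (ψ w)) = ψ.symm (ψ (constTensorDeriv F B w)) :=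
        congrArg ψ.symm (hψd w).symm
    _ = constTensorDeriv F B w := ψ.symm_apply_apply _
    _ = constTensorDeriv F B (ψ.symm (ψ w)) := by rw [ψ.symm_apply_apply]

/-! ### From constant groups to splittings -/

section LocallyFinite

theorem constTensorDeriv_smul {F B : Type u} [Field F] [Differential F] [CommRing B]
    [Algebra (constants F) B] (c : F) (z : F ⊗[constants F] B) :
    constTensorDeriv F B (c • z) = c • constTensorDeriv F B z + c′ • z := by
  induction z with
  | zero => simp
  | add p q hp hq => simp only [smul_add, map_add, hp, hq]; abel
  | tmul a b =>
    change ((c * a)′) ⊗ₜ b = c • ((a′) ⊗ₜ b) + (c′ * a) ⊗ₜ b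
    rw [TensorProduct.smul_tmul', ← TensorProduct.add_tmul]
    simp [mul_comm]

theorem exists_finset_mem_span_one_tmul {C F B : Type*} [CommRing C] [CommRing F] [Algebra C F]
    [AddCommGroup B] [Module C B] (z : F ⊗[C] B) :
    ∃ T : Finset B, z ∈ Submodule.span F ((fun b : B => (1 : F) ⊗ₜ[C] b) '' T) := by
  classical
  induction z with
  | zero => exact ⟨∅, zero_mem _⟩
  | add p q hp hq =>
    obtain ⟨T, hT⟩ := hp
    obtain ⟨T', hT'⟩ := hq
    refine ⟨T ∪ T', add_mem (Submodule.span_mono (Set.image_mono ?_) hT)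
      (Submodule.span_mono (Set.image_mono ?_) hT')⟩
    · exact Finset.coe_subset.mpr Finset.subset_union_left
    · exact Finset.coe_subset.mpr Finset.subset_union_right
  | tmul c b =>
    refine ⟨{b}, ?_⟩
    have h : c ⊗ₜ[C] b = c • ((1 : F) ⊗ₜ[C] b) := by
      rw [TensorProduct.smul_tmul', smul_eq_mul, mul_one]
    rw [h]
    exact Submodule.smul_mem _ _ (Submodule.subset_span ⟨b, by simp, rfl⟩)

/-- The coordinate ring of a group that is isomorphic to a group of constant points is a locally
finite differential module. -/
theorem DiffIsoConst.exists_submodule {K F A B : Type u} [Field K] [Differential K] [Field F]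
    [Differential F] [Algebra K F] [DifferentialAlgebra K F] [CommRing A] [HopfAlgebra K A]
    [Differential A] [DifferentialAlgebra K A] [CommRing B] [HopfAlgebra (constants F) B]
    (h : DiffIsoConst K F A B) (S : Finset A) :
    ∃ N : Submodule K A, FiniteDimensional K N ∧ (S : Set A) ⊆ N ∧ ∀ x ∈ N, x′ ∈ N := by
  classical
  obtain ⟨φ, hφ⟩ := h
  choose T hT using fun a : A => exists_finset_mem_span_one_tmul (φ ((1 : F) ⊗ₜ[K] a))
  -- ∂ kills each 1 ⊗ b, so a span of such elements is ∂-stable by the Leibniz rule.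
  let U : Submodule F (F ⊗[constants F] B) :=
    Submodule.span F ((fun b : B => (1 : F) ⊗ₜ[constants F] b) '' (S.biUnion T : Finset B))
  have hUfin : Module.Finite F U :=
    Module.Finite.span_of_finite F ((Finset.finite_toSet _).image _)
  have hU : ∀ z ∈ U, constTensorDeriv F B z ∈ U := by
    intro z hz
    induction hz using Submodule.span_induction with
    | mem z hz =>
      obtain ⟨b, -, rfl⟩ := hz
      have h1 : constTensorDeriv F B ((1 : F) ⊗ₜ b) = 0 := by
        change ((1 : F)′) ⊗ₜ b = 0
        simp
      rw [h1]
      exact zero_mem _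
    | zero => rw [map_zero]; exact zero_mem _
    | add p q _ _ hp hq => rw [map_add]; exact add_mem hp hq
    | smul c z hz hz' =>
      rw [constTensorDeriv_smul]
      exact add_mem (U.smul_mem _ hz') (U.smul_mem _ hz)
  let ι : A →ₗ[K] F ⊗[constants F] B :=
    (φ.toLinearEquiv.toLinearMap.restrictScalars K) ∘ₗ TensorProduct.mk K F A 1
  have hι : ∀ a, ι a = φ ((1 : F) ⊗ₜ a) := fun _ => rfl
  let N : Submodule K A := (U.restrictScalars K).comap ι
  refine ⟨N, ?_, ?_, ?_⟩
  -- A K-basis of N becomes an F-independent family in the finite-dimensional space U.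
  · let b := Module.Basis.ofVectorSpace K N
    have h1 : LinearIndependent K (fun i => (b i : A)) :=
      b.linearIndependent.map' N.subtype N.ker_subtype
    have h2 := (Module.Flat.linearIndependent_one_tmul (S := F) h1).map'
      φ.toLinearEquiv.toLinearMap (LinearEquiv.ker _)
    have h3 : LinearIndependent F (fun i => (⟨ι (b i), (b i).2⟩ : U)) :=
      LinearIndependent.of_comp U.subtype h2
    have := h3.finite
    exact Module.Finite.of_basis b
  · intro s hs
    exact Submodule.span_mono (Set.image_mono (Finset.coe_subset.mpr
      (Finset.subset_biUnion_of_mem T hs))) (hT s)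
  · intro x hx
    change φ ((1 : F) ⊗ₜ x′) ∈ U
    have h1 : (1 : F) ⊗ₜ[K] x′ = tensorDeriv K F A (1 ⊗ₜ x) := by simp [tensorDeriv_tmul]
    rw [h1, hφ]
    exact hU _ hx

end LocallyFinite

/-! ### Translates of functions and finite-dimensional subcomodules. -/

section RightContraction

variable {K A : Type*} [Field K] [CommRing A] [HopfAlgebra K A]

/-- The map `x ⊗ y ↦ f(y) x`. -/
noncomputable def contractRight (f : Module.Dual K A) : A ⊗[K] A →ₗ[K] A :=
  (TensorProduct.rid K A).toLinearMap ∘ₗ f.lTensor A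

theorem contractRight_tmul (f : Module.Dual K A) (x y : A) :
    contractRight f (x ⊗ₜ y) = f y • x := by
  simp [contractRight]

/-- The translate `a₁ f(a₂)` of `a`. -/
noncomputable def translate (f : Module.Dual K A) : A →ₗ[K] A :=
  contractRight f ∘ₗ Coalgebra.comul

theorem translate_counit (a : A) : translate (Coalgebra.counit (R := K)) a = a := by
  simp [translate, contractRight]

/-- By coassociativity, composing translations is translating by the convolution product of the
functionals. -/
theorem translate_translate (f g : Module.Dual K A) (a : A) : translate f (translate g a) =
    translate (LinearMap.mul' K K ∘ₗ TensorProduct.map f g ∘ₗ Coalgebra.comul) a := by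
  have h1 : ∀ z : A ⊗[K] A, translate f (contractRight g z) =
      (TensorProduct.rid K A) ((LinearMap.mul' K K ∘ₗ TensorProduct.map f g).lTensor A
        (TensorProduct.assoc K A A A ((Coalgebra.comul (R := K)).rTensor A z))) := by
    intro z
    induction z with
    | zero => simp
    | add p q hp hq => simp only [map_add, hp, hq]
    | tmul x y =>
      rw [contractRight_tmul, map_smul, translate, LinearMap.comp_apply, LinearMap.rTensor_tmul]
      generalize Coalgebra.comul (R := K) x = w
      induction w with
      | zero => simp
      | add p q hp hq => simp only [map_add, smul_add, TensorProduct.add_tmul, hp, hq]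
      | tmul p q => simp [contractRight_tmul, smul_smul, mul_comm]
  change translate f (contractRight g (Coalgebra.comul a)) = contractRight _ (Coalgebra.comul a)
  rw [h1, Coalgebra.coassoc_apply, contractRight, ← LinearMap.lTensor_comp_apply]
  rfl

/-- Expand z along a basis of the right factor; the coordinate functionals recover the left
coefficients. -/
theorem mem_range_rTensor_of_contractRight (W : Submodule K A) (z : A ⊗[K] A)
    (h : ∀ f, contractRight f z ∈ W) : z ∈ LinearMap.range (W.subtype.rTensor A) := by
  classical
  let e := Module.Basis.ofVectorSpace K A
  obtain ⟨c, rfl⟩ := TensorProduct.eq_repr_basis_right e z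
  refine sum_mem fun i hi => ?_
  have h1 : contractRight (e.coord i) (c.sum fun i x => x ⊗ₜ e i) = c i := by
    rw [map_finsuppSum]
    simp only [contractRight_tmul, Module.Basis.coord_apply, Module.Basis.repr_self,
      Finsupp.single_apply, ite_smul, one_smul, zero_smul]
    rw [Finsupp.sum, Finset.sum_ite_eq' c.support i c, if_pos hi]
  exact ⟨(⟨c i, h1 ▸ h (e.coord i)⟩ : W) ⊗ₜ e i, by simp⟩

/-- The span of the translates of a subspace. -/
noncomputable def translateSpan (N : Submodule K A) : Submodule K A :=
  Submodule.span K {x | ∃ a ∈ N, ∃ f : Module.Dual K A, translate f a = x}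

theorem le_translateSpan (N : Submodule K A) : N ≤ translateSpan N :=
  fun a ha => Submodule.subset_span ⟨a, ha, _, translate_counit a⟩

/-- All translates of a lie in the span of the left tensor factors of one expression of Δa, whatever
the functional. -/
theorem finiteDimensional_translateSpan (N : Submodule K A) [FiniteDimensional K N] :
    FiniteDimensional K (translateSpan N) := by
  classical
  have h1 : ∀ a : A, ∃ T : Finset A, ∀ f : Module.Dual K A,
      translate f a ∈ Submodule.span K (T : Set A) := by
    intro a
    simp only [translate, LinearMap.comp_apply]
    generalize Coalgebra.comul (R := K) a = z
    induction z with
    | zero => exact ⟨∅, fun f => by simp⟩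
    | add p q hp hq =>
      obtain ⟨T, hT⟩ := hp
      obtain ⟨T', hT'⟩ := hq
      refine ⟨T ∪ T', fun f => ?_⟩
      rw [map_add]
      exact add_mem (Submodule.span_mono (Finset.coe_subset.mpr Finset.subset_union_left) (hT f))
        (Submodule.span_mono (Finset.coe_subset.mpr Finset.subset_union_right) (hT' f))
    | tmul x y =>
      refine ⟨{x}, fun f => ?_⟩
      rw [contractRight_tmul]
      exact Submodule.smul_mem _ _ (Submodule.subset_span (by simp))
  choose T hT using h1
  obtain ⟨s, hs⟩ := (Submodule.fg_iff_finiteDimensional N).mpr inferInstance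
  let U := Submodule.span K ((s.biUnion T : Finset A) : Set A)
  have hU : ∀ a ∈ N, ∀ f : Module.Dual K A, translate f a ∈ U := by
    intro a ha f
    rw [← hs] at ha
    induction ha using Submodule.span_induction with
    | mem a ha =>
      exact Submodule.span_mono (Finset.coe_subset.mpr (Finset.subset_biUnion_of_mem T ha)) (hT a f)
    | zero => rw [map_zero]; exact zero_mem _
    | add p q _ _ hp hq => rw [map_add]; exact add_mem hp hq
    | smul c z _ hz => rw [map_smul]; exact U.smul_mem _ hz
  have hle : translateSpan N ≤ U := Submodule.span_le.mpr (by
    rintro _ ⟨a, ha, f, rfl⟩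
    exact hU a ha f)
  have : FiniteDimensional K U := FiniteDimensional.span_finset K _
  exact Submodule.finiteDimensional_of_le hle

theorem comul_mem_of_mem_translateSpan (N : Submodule K A) {w : A} (hw : w ∈ translateSpan N) :
    Coalgebra.comul (R := K) w ∈ LinearMap.range ((translateSpan N).subtype.rTensor A) := by
  refine mem_range_rTensor_of_contractRight _ _ fun f => ?_
  change translate f w ∈ translateSpan N
  rw [translateSpan] at hw
  induction hw using Submodule.span_induction with
  | mem x hx =>
    obtain ⟨a, ha, g, rfl⟩ := hx
    rw [translate_translate]
    exact Submodule.subset_span ⟨a, ha, _, rfl⟩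
  | zero => rw [map_zero]; exact zero_mem _
  | add p q _ _ hp hq => rw [map_add]; exact add_mem hp hq
  | smul c z _ hz => rw [map_smul]; exact Submodule.smul_mem _ _ hz

end RightContraction

/-! ### Derivations and translates. -/

section Derivative

variable {K A : Type u} [Field K] [Differential K] [CommRing A] [HopfAlgebra K A]
  [Differential A] [DifferentialAlgebra K A]

theorem deriv_smul (c : K) (x : A) : (c • x)′ = c • x′ + c′ • x := derivHom_smul c x

/-- The derivative `f ∘ ∂ - ∂ ∘ f` of a functional. -/
noncomputable def dualDeriv (f : Module.Dual K A) : Module.Dual K A where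
  toFun x := f (x′) - ((f x)′)
  map_add' x y := by simp only [map_add]; abel
  map_smul' c x := by
    simp only [deriv_smul, map_add, map_smul, smul_eq_mul, Derivation.leibniz, RingHom.id_apply]
    ring

/-- The functional f need not commute with ∂. Its defect `dualDeriv f` is again linear, so the
correction is another translate of a, and spans of translates inherit ∂-stability. -/
theorem translate_deriv [DiffHopfAlgebra K A] (f : Module.Dual K A) (a : A) :
    translate f a′ = (translate f a)′ + translate (dualDeriv f) a := by
  simp only [translate, LinearMap.comp_apply, DiffHopfAlgebra.comul_deriv]
  generalize Coalgebra.comul (R := K) a = z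
  induction z with
  | zero => simp
  | add p q hp hq => simp only [map_add, hp, hq]; abel
  | tmul x y =>
    simp only [tensorDeriv_tmul, map_add, contractRight_tmul, deriv_smul]
    change f y • x′ + f y′ • x = f y • x′ + (f y)′ • x + (f y′ - (f y)′) • x
    rw [sub_smul]
    abel

theorem deriv_mem_translateSpan [DiffHopfAlgebra K A] {N : Submodule K A}
    (hN : ∀ x ∈ N, x′ ∈ N) {x : A} (hx : x ∈ translateSpan N) : x′ ∈ translateSpan N := by
  rw [translateSpan] at hx
  induction hx using Submodule.span_induction with
  | mem x hx =>
    obtain ⟨a, ha, f, rfl⟩ := hx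
    rw [← add_sub_cancel_right ((translate f a)′) (translate (dualDeriv f) a), ← translate_deriv]
    exact sub_mem (Submodule.subset_span ⟨_, hN a ha, _, rfl⟩)
      (Submodule.subset_span ⟨a, ha, _, rfl⟩)
  | zero => rw [map_zero]; exact zero_mem _
  | add p q _ _ hp hq => rw [map_add]; exact add_mem hp hq
  | smul c z hz hz' =>
    rw [deriv_smul]
    exact add_mem (Submodule.smul_mem _ _ hz') (Submodule.smul_mem _ _ hz)

end Derivative

namespace DiffRep

/-! ### Subcomodules of the coordinate ring. -/

section Submodule

variable {K A : Type u} [Field K] [CommRing A] [HopfAlgebra K A]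

/-- A subspace of the coordinate ring that is stable under right translations is a
representation. -/
theorem exists_of_submodule (W : Submodule K A)
    (hW : ∀ w ∈ W, Coalgebra.comul (R := K) w ∈ LinearMap.range (W.subtype.rTensor A)) :
    ∃ r : DiffRep K A W, ∀ w : W, W.subtype.rTensor A (r.coact w) = Coalgebra.comul (w : A) := by
  have hj : Function.Injective (W.subtype.rTensor A) :=
    Module.Flat.rTensor_preserves_injective_linearMap _ W.injective_subtype
  let ρ : W →ₗ[K] W ⊗[K] A := (LinearEquiv.ofInjective _ hj).symm.toLinearMap ∘ₗ
    (Coalgebra.comul ∘ₗ W.subtype).codRestrict _ (fun w => hW w w.2)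
  have hρ : ∀ w : W, W.subtype.rTensor A (ρ w) = Coalgebra.comul (w : A) := fun w =>
    congrArg Subtype.val ((LinearEquiv.ofInjective _ hj).apply_symm_apply _)
  have hρ' : W.subtype.rTensor A ∘ₗ ρ = Coalgebra.comul ∘ₗ W.subtype := LinearMap.ext hρ
  refine ⟨⟨ρ, fun w => ?_, fun w => ?_⟩, hρ⟩
  · have hj₂ : Function.Injective (W.subtype.rTensor (A ⊗[K] A)) :=
      Module.Flat.rTensor_preserves_injective_linearMap _ W.injective_subtype
    apply hj₂
    have h1 : ∀ z : (W ⊗[K] A) ⊗[K] A,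
        W.subtype.rTensor (A ⊗[K] A) (TensorProduct.assoc K W A A z) =
          TensorProduct.assoc K A A A ((W.subtype.rTensor A).rTensor A z) := by
      intro z
      rw [LinearMap.rTensor_tensor]
      simp
    rw [h1, ← LinearMap.rTensor_comp_apply, hρ', LinearMap.rTensor_comp_apply, hρ,
      Coalgebra.coassoc_apply, ← hρ]
    have h2 : ∀ z : W ⊗[K] A, (Coalgebra.comul (R := K)).lTensor A (W.subtype.rTensor A z) =
        W.subtype.rTensor (A ⊗[K] A) ((Coalgebra.comul (R := K)).lTensor W z) := by
      intro z
      rw [← LinearMap.comp_apply, ← LinearMap.comp_apply, LinearMap.lTensor_comp_rTensor,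
        LinearMap.rTensor_comp_lTensor]
    exact h2 _
  · apply W.injective_subtype
    have h1 : ∀ z : W ⊗[K] K, W.subtype (TensorProduct.rid K W z) =
        TensorProduct.rid K A (W.subtype.rTensor K z) := by
      intro z
      induction z with
      | zero => simp
      | add a b ha hb => simp only [map_add, ha, hb]
      | tmul a b => simp
    rw [h1, ← LinearMap.comp_apply (W.subtype.rTensor K), LinearMap.rTensor_comp_lTensor,
      ← LinearMap.lTensor_comp_rTensor, LinearMap.comp_apply, hρ, Coalgebra.lTensor_counit_comul]
    simp

/-- Applying the counit to the translate of w by g gives g(w). The action thus determines g on W,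
hence on a set of differential generators. -/
theorem isFaithful_of_subset [Differential K] [Differential A] {W : Submodule K A}
    {r : DiffRep K A W} (hr : ∀ w : W, W.subtype.rTensor A (r.coact w) = Coalgebra.comul (w : A))
    {S : Set A} (hS : S ⊆ W) (hgen : diffAdjoin K S = ⊤) : r.IsFaithful := by
  intro B _ _ _ _ g₁ g₂ h
  have hact : ∀ (g : Points K A B) (w : W), g.1 w = TensorProduct.lid K B
      ((Coalgebra.counit ∘ₗ W.subtype).rTensor B (r.act g w)) := by
    intro g w
    have h1 : ∀ z : A ⊗[K] A, TensorProduct.lid K B ((Coalgebra.counit (R := K)).rTensor B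
        (g.1.toLinearMap.lTensor A z)) =
        g.1 (TensorProduct.lid K A ((Coalgebra.counit (R := K)).rTensor A z)) := by
      intro z
      induction z with
      | zero => simp
      | add a b ha hb => simp only [map_add, ha, hb]
      | tmul a b => simp
    rw [LinearMap.rTensor_comp_apply, act, LinearMap.comp_apply,
      ← LinearMap.comp_apply (W.subtype.rTensor B), LinearMap.rTensor_comp_lTensor,
      ← LinearMap.lTensor_comp_rTensor, LinearMap.comp_apply, hr, h1,
      Coalgebra.rTensor_counit_comul]
    simp
  have hle : diffAdjoin K S ≤ AlgHom.equalizer g₁.1 g₂.1 := by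
    refine diffAdjoin_le (fun s hs => ?_) (fun x hx => ?_)
    · have h1 := hact g₁ ⟨s, hS hs⟩
      have h2 := hact g₂ ⟨s, hS hs⟩
      exact h1.trans ((by rw [show r.act g₁ = r.act g₂ from h]) : _ = _) |>.trans h2.symm
    · change g₁.1 x′ = g₂.1 x′
      rw [g₁.2, g₂.2, show g₁.1 x = g₂.1 x from hx]
  refine Subtype.ext (AlgHom.ext fun a => ?_)
  rw [hgen] at hle
  exact hle (Algebra.mem_top (x := a))

/-- An isomorphism of representations stays one after base change. -/
theorem coactBaseChange_baseChange {V W : Type u} [AddCommGroup V] [Module K V]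
    [AddCommGroup W] [Module K W] {F : Type u} [Field F] [Algebra K F] {r : DiffRep K A V} {s : DiffRep K A W} {e : V →ₗ[K] W}
    (he : ∀ v, s.coact (e v) = e.rTensor A (r.coact v)) (x : F ⊗[K] V) :
    s.coactBaseChange F (e.lTensor F x) =
      (e.lTensor F).rTensor A (r.coactBaseChange F x) := by
  induction x with
  | zero => simp
  | add p q hp hq => simp only [map_add, hp, hq]
  | tmul c v =>
    simp only [coactBaseChange, LinearMap.comp_apply, LinearMap.lTensor_tmul, he,
      LinearEquiv.coe_coe]
    generalize r.coact v = z
    induction z with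
    | zero => simp
    | add p q hp hq => simp only [map_add, TensorProduct.tmul_add, hp, hq]
    | tmul p q => simp

end Submodule

/-! ### Splitting the prolongation by a derivation. -/

section Splitting

variable {K A V : Type u} [Field K] [Differential K] [CommRing A] [HopfAlgebra K A]
  [Differential A] [DifferentialAlgebra K A] [AddCommGroup V] [Module K V]

/-- The prolongation of a representation with a compatible derivation splits. -/
theorem prolongSplits_of_deriv [DiffHopfAlgebra K A] (F : Type u) [Field F] [Algebra K F]
    (r : DiffRep K A V) (D : V →+ V) (hD : ∀ (c : K) (v : V), D (c • v) = c • D v + c′ • v)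
    (hr : ∀ v, r.coact (D v) =
      tensorLeibniz LinearMap.id D hD (derivHom A) (fun c a => derivHom_smul c a) (r.coact v)) :
    r.ProlongSplits F r := by
  -- This sends ∂ ⊗ v to (Dv, v). The term c′v in D(cv) matches the one in ∂ ⊗ cv, which makes the
  -- map K-linear.
  let f : Prolong K V →ₗ[K] V × V := Prolong.lift (LinearMap.inl K V V)
    (D.prod (AddMonoidHom.id V)) (by
      intro c v
      refine Prod.ext ?_ ?_
      · simp [hD]
      · simp)
  have hfi : ∀ v, f (Prolong.incl K v) = (v, 0) := fun v => Prolong.lift_incl _ _ _ v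
  have hfd : ∀ v, f (Prolong.del K v) = (D v, v) := fun v => Prolong.lift_del _ _ _ v
  have hf : ∀ x, f x = (x.1 + D x.2, x.2) := by
    intro x
    conv_lhs => rw [Prolong.eq_incl_add_del K x]
    rw [map_add, hfi, hfd]
    simp
  let e : Prolong K V ≃ₗ[K] V × V := LinearEquiv.ofBijective f
    ⟨by
      intro x y hxy
      rw [hf, hf, Prod.mk.injEq] at hxy
      have h2 : x.2 = y.2 := hxy.2
      refine Prod.ext ?_ h2
      have h1 := hxy.1
      rw [h2] at h1
      exact add_right_cancel h1,
    fun p => ⟨((p.1 - D p.2, p.2) : V × V),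
      (hf _).trans (Prod.ext (sub_add_cancel _ _) rfl)⟩⟩
  have he : ∀ x, (r.directSum r).coact (f x) = f.rTensor A (r.prolong.coact x) := by
    intro x
    rw [Prolong.eq_incl_add_del K x, map_add, map_add, map_add, map_add]
    congr 1
    · have h1 : r.prolong.coact (Prolong.incl K x.1) =
          (Prolong.incl K).rTensor A (r.coact x.1) := r.prolongCoact_incl x.1
      have h2 : f ∘ₗ Prolong.incl K = LinearMap.inl K V V := LinearMap.ext hfi
      rw [h1, ← LinearMap.rTensor_comp_apply, h2, hfi]
      simp [directSum]
    · have h1 : r.prolong.coact (Prolong.del K x.2) = delTensor K A V (r.coact x.2) :=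
        r.prolongCoact_del x.2
      rw [h1, hfd]
      simp only [directSum, LinearMap.coprod_apply, LinearMap.comp_apply, hr]
      generalize r.coact x.2 = z
      induction z with
      | zero => simp
      | add p q hp hq =>
        simp only [map_add] at hp hq ⊢
        rw [← hp, ← hq]
        abel
      | tmul p q =>
        have h3 : (D p, p) = (D p, (0 : V)) + ((0 : V), p) := by simp
        simp only [tensorLeibniz_tmul, delTensor_tmul, map_add, LinearMap.rTensor_tmul, hfd, hfi,
          LinearMap.inl_apply, LinearMap.inr_apply, LinearMap.id_apply, derivHom_apply]
        rw [h3, TensorProduct.add_tmul]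
        abel
  refine ⟨e.baseChange K F _ _, fun x => ?_, fun c v => ?_⟩
  · exact coactBaseChange_baseChange he x
  · exact congrArg (c ⊗ₜ[K] ·) (hfi v)

end Splitting

end DiffRep

/-- The coordinate ring of a group of constant points over some extension contains a faithful
representation whose prolongation splits. -/
theorem exists_prolongSplits_of_diffIsoConst {K F A B : Type u} [Field K] [Differential K] [Field F]
    [Differential F] [Algebra K F] [DifferentialAlgebra K F] [CommRing A] [HopfAlgebra K A]
    [Differential A] [DifferentialAlgebra K A] [IsLinearDiffAlgGroup K A] [CommRing B]
    [HopfAlgebra (constants F) B] (h : DiffIsoConst K F A B) :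
    ∃ (W : Submodule K A) (_ : FiniteDimensional K W) (r : DiffRep K A W),
      r.IsFaithful ∧ r.ProlongSplits F r := by
  obtain ⟨S, hS⟩ := IsLinearDiffAlgGroup.diffFinite (K := K) (A := A)
  obtain ⟨N, hNfin, hSN, hN⟩ := h.exists_submodule S
  have hW : ∀ x ∈ translateSpan N, x′ ∈ translateSpan N := fun x => deriv_mem_translateSpan hN
  obtain ⟨r, hr⟩ := DiffRep.exists_of_submodule (translateSpan N)
    (fun w => comul_mem_of_mem_translateSpan N)
  refine ⟨translateSpan N, finiteDimensional_translateSpan N, r,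
    DiffRep.isFaithful_of_subset hr (hSN.trans (le_translateSpan N)) hS, ?_⟩
  -- The derivation of A restricts to W, and its compatibility with the coaction is that of Δ with
  -- ∂, tested after the injection W ⊗ A → A ⊗ A.
  let D : translateSpan N →+ translateSpan N :=
    AddMonoidHom.mk' (fun x => ⟨(x : A)′, hW x x.2⟩) (fun x y => Subtype.ext (map_add _ _ _))
  refine r.prolongSplits_of_deriv F D (fun c v => Subtype.ext (deriv_smul c (v : A))) fun v => ?_
  have hj : Function.Injective ((translateSpan N).subtype.rTensor A) :=
    Module.Flat.rTensor_preserves_injective_linearMap _ (translateSpan N).injective_subtype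
  apply hj
  rw [hr]
  change Coalgebra.comul (R := K) ((v : A)′) = _
  rw [DiffHopfAlgebra.comul_deriv, ← hr]
  generalize r.coact v = z
  induction z with
  | zero => simp
  | add p q hp hq => simp only [map_add, hp, hq]
  | tmul p q => simp [tensorDeriv_tmul, D]

end DiffAlgGroup

/-! ### The equivalence. -/

theorem mainTheorem8 (K : Type u) [Field K] [CharZero K] [Differential K]
    (Kbar : Type u) [Field Kbar] [Differential Kbar] [Algebra K Kbar] [DifferentialAlgebra K Kbar]
    (hKbar : DiffAlgGroup.IsDifferentialClosure K Kbar)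
    (A : Type u) [CommRing A] [HopfAlgebra K A] [Differential A] [DifferentialAlgebra K A]
    [DiffAlgGroup.IsLinearDiffAlgGroup K A] :
    DiffAlgGroup.IsIsoToConstantGroup K Kbar A ↔
      ∃ (W : Type u) (_ : AddCommGroup W) (_ : Module K W) (_ : FiniteDimensional K W)
        (r : DiffAlgGroup.DiffRep K A W),
        r.IsFaithful ∧
        ∃ (W₁ : Type u) (_ : AddCommGroup W₁) (_ : Module K W₁) (r₁ : DiffAlgGroup.DiffRep K A W₁),
          r₁.Iso r ∧ r.ProlongSplits Kbar r₁ := by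
  constructor
  · rintro ⟨_, _, _, _, _, _, h⟩
    obtain ⟨W, hW, r, hr, hs⟩ := DiffAlgGroup.exists_prolongSplits_of_diffIsoConst h
    -- The complement is W itself, with the identity as the isomorphism.
    exact ⟨W, inferInstance, inferInstance, hW, r, hr, W, inferInstance, inferInstance, r,
      ⟨LinearEquiv.refl K W, fun v => by simp⟩, hs⟩
  · rintro ⟨_, _, _, _, r, hr, _, _, _, _, _, hs⟩
    exact DiffAlgGroup.isIsoToConstantGroup_of_prolongSplits hKbar.closed hr hs
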